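/- Let $n\in\mathbb{N}$ and let $\Omega\subset\mathbb{R}^n$ be an open set containing the origin $O$. For an open set $\omega$, $\mathcal{D}(\omega)$ denotes the real-valued smooth functions with compact support in $\omega$ and $\mathcal{D}'(\omega)$ the real-valued distributions on $\omega$. For $\omega\in\{\Omega,\Omega-O\}$ and $T\in\mathcal{D}'(\omega)$, choose $r>0$ such that the open ball $B_r$ of radius $r$ around $O$ lies in $\Omega$. The scaling degree of $T$ (with respect to $O$) is $$\operatorname{sd}(T)=\inf\Big\{k\in\mathbb{R}\;\Big|\;\lim_{\lambda\to0^+}\lambda^k\,T|_{\omega\cap B_r}(\phi_\lambda)=0\ \text{ for all }\phi\in\mathcal{D}(\omega\cap B_r)\Big\}\in[-\infty,+\infty],\qquad \phi_\lambda(x)=\lambda^{-n}\phi(x/\lambda)\quad(0<\lambda<1),$$ which does not depend on $r$, and the degree of divergence of $T$ is $\operatorname{deg}(T)=\operatorname{sd}(T)-n$. Lemma. Let $T_0\in\mathcal{D}'(\Omega-O)$ have $\operatorname{deg}(T_0)<+\infty$ (in particular, $T_0$ may be any distribution with finite degree of divergence). Then there exists $T\in\mathcal{D}'(\Omega)$ such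 that $T|_{\Omega-O}=T_0$ and $\operatorname{deg}(T)=\operatorname{deg}(T_0)$. Moreover: a. If $\operatorname{deg}(T_0)<0$, there is exactly one $T\in\mathcal{D}'(\Omega)$ with $T|_{\Omega-O}=T_0$ and $\operatorname{deg}(T)=\operatorname{deg}(T_0)$. b. If $\operatorname{deg}(T_0)\ge 0$ and $T_1,T_2\in\mathcal{D}'(\Omega)$ satisfy $T_1|_{\Omega-O}=T_2|_{\Omega-O}=T_0$ and $\operatorname{deg}(T_1)=\operatorname{deg}(T_2)=\operatorname{deg}(T_0)$, then there are $c_\alpha\in\mathbb{R}$ such that $$T_1-T_2=\sum_{\alpha\in\mathbb{N}^n,\ |\alpha|\le\operatorname{deg}(T_0)}c_\alpha\,\partial^\alpha\delta_O,$$ where $\delta_O(\psi)=\psi(O)$. -/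

import Mathlib

open Filter Topology TopologicalSpace
open scoped Distributions LineDeriv

noncomputable section

namespace ScalingDegree

/-- The punctured open set `Ω - O`, where `O` is the origin of `ℝⁿ`. -/
def puncture {n : ℕ} (Ω : Opens (EuclideanSpace ℝ (Fin n))) :
    Opens (EuclideanSpace ℝ (Fin n)) :=
  ⟨(Ω : Set (EuclideanSpace ℝ (Fin n))) \ {0}, Ω.isOpen.sdiff isClosed_singleton⟩

theorem puncture_le {n : ℕ} (Ω : Opens (EuclideanSpace ℝ (Fin n))) : puncture Ω ≤ Ω :=
  fun _ hx => hx.1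

/-- The open ball `B_r` of radius `r` centred at the origin, intersected with `ω`. When `B_r ⊆ Ω`
this is `B_r` for `ω = Ω`, and it is `B_r - O` for `ω = Ω - O`. -/
def ballIn {n : ℕ} (ω : Opens (EuclideanSpace ℝ (Fin n))) (r : ℝ) :
    Opens (EuclideanSpace ℝ (Fin n)) :=
  ⟨(ω : Set (EuclideanSpace ℝ (Fin n))) ∩ Metric.ball 0 r, ω.isOpen.inter Metric.isOpen_ball⟩

theorem ballIn_le {n : ℕ} (ω : Opens (EuclideanSpace ℝ (Fin n))) (r : ℝ) : ballIn ω r ≤ ω :=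
  fun _ hx => hx.1

/-- The restriction `T|_ω` of a distribution `T` on `Ω` to an open subset `ω ⊆ Ω`:
`T|_ω (ψ) = T (ψ extended by zero)`. Mathlib's test functions on `ω` are functions on the whole
space with compact support inside `ω`, so extension by zero is the inclusion
`TestFunction.monoCLM`. -/
def restrict {n : ℕ} {Ω ω : Opens (EuclideanSpace ℝ (Fin n))} (_h : ω ≤ Ω) (T : 𝓓'(Ω, ℝ)) :
    𝓓'(ω, ℝ) :=
  ContinuousLinearMap.precompCompactConvergenceCLM ℝ
    (TestFunction.monoCLM ℝ : 𝓓(ω, ℝ) →L[ℝ] 𝓓(Ω, ℝ)) T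

open scoped Classical in
/-- The rescaled test function `φ_t(x) = t⁻ⁿ φ(x / t)`, for `t > 0` and for an open set `U` with
`t U ⊆ U` (such as `B_r` and `B_r - O`, for `0 < t ≤ 1`). For other `t` and `U`, which never
matter below, the value is `0`. -/
def rescale {n : ℕ} {U : Opens (EuclideanSpace ℝ (Fin n))} (t : ℝ) (φ : 𝓓(U, ℝ)) : 𝓓(U, ℝ) :=
  if h : 0 < t ∧ ∀ x ∈ U, t • x ∈ U then
    { toFun := fun x => (t ^ n)⁻¹ * φ (t⁻¹ • x)
      contDiff' := by
        have := φ.contDiff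
        fun_prop
      hasCompactSupport' :=
        (φ.hasCompactSupport.comp_homeomorph
          (Homeomorph.smulOfNeZero t⁻¹ (inv_ne_zero h.1.ne'))).mul_left
      tsupport_subset' := by
        intro x hx
        have h1 : t⁻¹ • x ∈ tsupport φ :=
          tsupport_comp_subset_preimage φ (f := fun x => t⁻¹ • x) (by fun_prop)
            (tsupport_mul_subset_right hx)
        have h2 := h.2 _ (φ.tsupport_subset h1)
        rwa [smul_smul, mul_inv_cancel₀ h.1.ne', one_smul] at h2 }
  else 0

theorem rescale_apply {n : ℕ} {U : Opens (EuclideanSpace ℝ (Fin n))} {t : ℝ} (ht : 0 < t)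
    (hU : ∀ x ∈ U, t • x ∈ U) (φ : 𝓓(U, ℝ)) (x : EuclideanSpace ℝ (Fin n)) :
    rescale t φ x = (t ^ n)⁻¹ * φ (t⁻¹ • x) := by
  rw [rescale, dif_pos ⟨ht, hU⟩]
  rfl

/-- The sets on which `rescale` is used below are stable under contractions towards the origin. -/
theorem smul_mem_ballIn {n : ℕ} {ω : Opens (EuclideanSpace ℝ (Fin n))} {r : ℝ}
    (hr : Metric.ball 0 r \ {0} ⊆ (ω : Set (EuclideanSpace ℝ (Fin n)))) {t : ℝ} (ht : 0 < t)
    (ht1 : t ≤ 1) : ∀ x ∈ ballIn ω r, t • x ∈ ballIn ω r := by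
  rintro x ⟨hx, hxr⟩
  have hb : t • x ∈ Metric.ball (0 : EuclideanSpace ℝ (Fin n)) r := by
    rw [mem_ball_zero_iff] at hxr ⊢
    rw [norm_smul, Real.norm_of_nonneg ht.le]
    exact (mul_le_of_le_one_left (norm_nonneg x) ht1).trans_lt hxr
  refine ⟨?_, hb⟩
  by_cases h0 : x = 0
  · simpa [h0] using hx
  · exact hr ⟨hb, by simp [h0, ht.ne']⟩

/-- `t ^ k T_t → 0` in the sense of distributions as `t → 0⁺`, where `T_t(φ) = T(φ_t)`: this is
tested on the balls `B_r ⊆ Ω` (if `T` lives on `ω = Ω`, containing `O`) or on the punctured balls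
`B_r - O` (if `T` lives on `ω = Ω - O`). -/
def IsScalingExponent {n : ℕ} {ω : Opens (EuclideanSpace ℝ (Fin n))} (T : 𝓓'(ω, ℝ)) (k : ℝ) :
    Prop :=
  ∀ r : ℝ, 0 < r → Metric.ball 0 r \ {0} ⊆ (ω : Set (EuclideanSpace ℝ (Fin n))) →
    ∀ φ : 𝓓(ballIn ω r, ℝ),
      Tendsto (fun t : ℝ => t ^ k * restrict (ballIn_le ω r) T (rescale t φ)) (𝓝[>] 0) (𝓝 0)

/-- The scaling degree `sd(T) = inf {k ∈ ℝ | t ^ k T_t → 0}` with respect to the origin, as an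
extended real number. -/
def sd {n : ℕ} {ω : Opens (EuclideanSpace ℝ (Fin n))} (T : 𝓓'(ω, ℝ)) : EReal :=
  sInf ((fun k : ℝ => (k : EReal)) '' {k : ℝ | IsScalingExponent T k})

/-- The degree of divergence `deg(T) = sd(T) - n`. -/
def deg {n : ℕ} {ω : Opens (EuclideanSpace ℝ (Fin n))} (T : 𝓓'(ω, ℝ)) : EReal :=
  sd T - ((n : ℝ) : EReal)

/-- `∂^α T = ∂₁^{α₁} ∂₂^{α₂} ⋯ ∂ₙ^{αₙ} T` for a multi-index `α`. -/
def partialDeriv {n : ℕ} {Ω : Opens (EuclideanSpace ℝ (Fin n))} (α : Fin n → ℕ)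
    (T : 𝓓'(Ω, ℝ)) : 𝓓'(Ω, ℝ) :=
  (List.finRange n).foldr
    (fun i S => (fun R : 𝓓'(Ω, ℝ) => ∂_{EuclideanSpace.single i (1 : ℝ)} R)^[α i] S) T

/-- `T` is an extension of `T₀` (from `Ω - O` to `Ω`) with the same degree of divergence. -/
def IsExtensionOfSameDegree {n : ℕ} {Ω : Opens (EuclideanSpace ℝ (Fin n))}
    (T₀ : 𝓓'(puncture Ω, ℝ)) (T : 𝓓'(Ω, ℝ)) : Prop :=
  restrict (puncture_le Ω) T = T₀ ∧ deg T = deg T₀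

end ScalingDegree

end

/-! Let `m` be the least natural number with `deg T₀ < m`, and let `χ` be a cutoff equal to `1` near
the origin. The extension is `T f = T₀((1 - χ) f) + ∑ⱼ T₀(ηⱼ (f - P f))`, where `P f` is the Taylor
polynomial of `f` at `O` of degree less than `m`, and the annular functions `ηⱼ` at scale `2⁻ʲ` sum
to `χ` away from `O`.

If `k` is a scaling exponent of `T₀`, Banach-Steinhaus makes the decay at scale `2⁻ʲ` uniform in the
test function (`exists_dyadic_bound`). The remainder `f - P f` gains a factor `2⁻ʲᵐ`, so the `j`-th
term is `O(2⁻ʲ⁽ⁿ⁺ᵐ⁻ᵏ⁾)` and the series converges for `k < n + m`; its sum is a distribution, again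
by Banach-Steinhaus.

For the degree, `f` is replaced by its rescaling by `l`. With `u = 2⁻ʲ / l` the terms are at most a
constant times `l⁻ᵏ uⁿ⁺ᵐ⁻ᵏ min(1, u⁻ᑫ)`. Here `q = 1` is allowed because `P f` has degree at most `m
- 1`, and any `q` is allowed if `m = 0`, since then nothing is subtracted. For `k` just above `sd
T₀` one has `0 < n + m - k < q`, so the sum over `j` is bounded uniformly in `l`
(`exists_dyadic_sum_bound`). This is `exists_extension`.

The difference of two extensions is supported at `O` and has a scaling exponent below `n + m`. It
kills functions whose jet of order less than `m` vanishes (`app_eq_zero_of_jet_eq_zero`), hence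
depends only on that jet, and so is a combination of `∂^α δ` with `|α| < m`. For negative degree `m
= 0` and the difference is zero. -/

namespace ScalingDegree
open scoped ContDiff

/-! ### Completeness and the Baire property of smooth functions supported in a compact set. -/

section Complete

variable {E F : Type*} [NormedAddCommGroup E] [NormedSpace ℝ E] [NormedAddCommGroup F]
  [NormedSpace ℝ F] [CompleteSpace F] {K : Compacts E}

/-- The jet map embeds the space in a product of spaces of bounded continuous functions, so it
suffices that its range is closed: uniform limits of all derivatives form the Taylor series of the
limit function. -/
instance completeSpace_contDiffMapSupportedIn : CompleteSpace 𝓓_{K}(E, F) := by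
  have hemb := ContDiffMapSupportedIn.isUniformEmbedding_pi_structureMapCLM (E := E) (F := F)
    (n := ⊤) (K := K) ℝ
  rw [completeSpace_iff_isComplete_range hemb.isUniformInducing]
  refine IsClosed.isComplete (isClosed_of_closure_subset fun g hg => ?_)
  set Φ := ContinuousLinearMap.pi (ContDiffMapSupportedIn.structureMapCLM (E := E) (F := F)
    (K := K) ℝ ⊤) with hΦ
  set l := comap Φ (𝓝 g)
  have : l.NeBot := comap_neBot_iff_frequently.2 (mem_closure_iff_frequently.1 hg)
  have hl : Tendsto Φ l (𝓝 g) := tendsto_comap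
  have hunif : ∀ i, TendstoUniformly (fun (φ : 𝓓_{K}(E, F)) x => iteratedFDeriv ℝ i φ x) (g i) l := by
    intro i
    have h1 := (tendsto_pi_nhds.1 hl) i
    have h2 := BoundedContinuousFunction.tendsto_iff_tendstoUniformly.1 h1
    simpa [hΦ, ContDiffMapSupportedIn.structureMapCLM_apply] using h2
  have hpt : ∀ i x, Tendsto (fun (φ : 𝓓_{K}(E, F)) => iteratedFDeriv ℝ i φ x) l (𝓝 (g i x)) :=
    fun i x => (hunif i).tendsto_at x
  have htay : HasFTaylorSeriesUpTo ∞ (fun x => (g 0 x).curry0) (fun x i => g i x) := by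
    refine (hasFTaylorSeriesUpTo_top_iff' le_rfl).2 ⟨fun _ => rfl, fun m x => ?_⟩
    refine hasFDerivAt_of_tendstoUniformly (l := l)
      (f' := fun (φ : 𝓓_{K}(E, F)) x => (iteratedFDeriv ℝ (m + 1) φ x).curryLeft)
      (g' := fun x => (g (m + 1) x).curryLeft) ?_ ?_ (hpt m) x
    · exact (continuousMultilinearCurryLeftEquiv ℝ
        (fun _ : Fin (m + 1) => E) F).isometry.uniformContinuous.comp_tendstoUniformly (hunif (m + 1))
    · intro φ x
      have := ((contDiff_iff_ftaylorSeries.1 φ.contDiff).fderiv m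
        (WithTop.coe_lt_coe.2 (ENat.natCast_lt_top m)) x)
      exact this
  have hzero : ∀ x ∉ K, (g 0 x).curry0 = 0 := by
    intro x hx
    have : g 0 x = 0 := by
      refine tendsto_nhds_unique (hpt 0 x) ?_
      refine tendsto_const_nhds.congr fun φ => ?_
      exact (φ.iteratedFDeriv_zero_on_compl hx).symm
    rw [this]; rfl
  refine ⟨⟨fun x => (g 0 x).curry0, htay.contDiff, fun x hx => hzero x hx⟩, ?_⟩
  ext i x : 2
  have := htay.eq_iteratedFDeriv (m := i) (mod_cast le_top) x
  simp only [hΦ, ContinuousLinearMap.coe_pi', ContDiffMapSupportedIn.structureMapCLM_apply, le_top,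
    if_true]
  exact this.symm

/-- A countable family of orders of differentiation gives a countably generated uniformity, so
completeness yields Baire. This is what feeds Banach-Steinhaus. -/
instance baireSpace_contDiffMapSupportedIn : BaireSpace 𝓓_{K}(E, F) := by
  have hemb := ContDiffMapSupportedIn.isUniformEmbedding_pi_structureMapCLM (E := E) (F := F)
    (n := ⊤) (K := K) ℝ
  have : (uniformity 𝓓_{K}(E, F)).IsCountablyGenerated := by
    rw [← hemb.isUniformInducing.comap_uniformity]
    infer_instance
  infer_instance

end Complete

/-! ### Distributions as functionals with seminorm bounds; Banach-Steinhaus. -/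

section Functionals

variable {E : Type*} [NormedAddCommGroup E] [NormedSpace ℝ E]

/-- `f` is (the underlying function of) a test function on `U`. -/
structure IsTest (U : Opens E) (f : E → ℝ) : Prop where
  contDiff : ContDiff ℝ ∞ f
  hasCompactSupport : HasCompactSupport f
  tsupport_subset : tsupport f ⊆ U

/-- The bundled test function with underlying function `f`. -/
def IsTest.toTestFunction {U : Opens E} {f : E → ℝ} (h : IsTest U f) : 𝓓(U, ℝ) :=
  ⟨f, h.contDiff, h.hasCompactSupport, h.tsupport_subset⟩

open scoped Classical in
/-- The value of a distribution on an unbundled test function. -/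
noncomputable def app {U : Opens E} (T : 𝓓'(U, ℝ)) (f : E → ℝ) : ℝ :=
  if h : IsTest U f then T h.toTestFunction else 0

theorem isTest_coe {U : Opens E} (φ : 𝓓(U, ℝ)) : IsTest U φ :=
  ⟨φ.contDiff, φ.hasCompactSupport, φ.tsupport_subset⟩

theorem app_coe {U : Opens E} (T : 𝓓'(U, ℝ)) (φ : 𝓓(U, ℝ)) : app T φ = T φ := by
  rw [app, dif_pos (isTest_coe φ)]
  rfl

theorem app_eq {U : Opens E} (T : 𝓓'(U, ℝ)) {f : E → ℝ} (h : IsTest U f) :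
    app T f = T h.toTestFunction := dif_pos h

theorem distribution_ext {U : Opens E} {S T : 𝓓'(U, ℝ)} (h : ∀ f, IsTest U f → app S f = app T f) :
    S = T := by
  ext φ
  have := h φ (isTest_coe φ)
  rwa [app_coe, app_coe] at this

theorem IsTest.mono {U V : Opens E} {f : E → ℝ} (h : IsTest U f) (hU : U ≤ V) : IsTest V f :=
  ⟨h.contDiff, h.hasCompactSupport, h.tsupport_subset.trans hU⟩

theorem IsTest.add {U : Opens E} {f g : E → ℝ} (hf : IsTest U f) (hg : IsTest U g) :
    IsTest U (fun x => f x + g x) :=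
  isTest_coe (hf.toTestFunction + hg.toTestFunction)

theorem IsTest.sub {U : Opens E} {f g : E → ℝ} (hf : IsTest U f) (hg : IsTest U g) :
    IsTest U (fun x => f x - g x) :=
  isTest_coe (hf.toTestFunction - hg.toTestFunction)

theorem IsTest.const_mul {U : Opens E} {f : E → ℝ} (hf : IsTest U f) (c : ℝ) :
    IsTest U (fun x => c * f x) :=
  isTest_coe (c • hf.toTestFunction)

/-- A smooth function times a test function. -/
theorem IsTest.mul_left {U : Opens E} {f g : E → ℝ} (hf : IsTest U f) (hg : ContDiff ℝ ∞ g) :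
    IsTest U (fun x => g x * f x) :=
  ⟨hg.mul hf.contDiff, hf.hasCompactSupport.mul_left,
    (tsupport_mul_subset_right (f := g)).trans hf.tsupport_subset⟩

theorem IsTest.mul_right {U : Opens E} {f g : E → ℝ} (hf : IsTest U f) (hg : ContDiff ℝ ∞ g) :
    IsTest U (fun x => f x * g x) :=
  ⟨hf.contDiff.mul hg, hf.hasCompactSupport.mul_right,
    (tsupport_mul_subset_left (f := f)).trans hf.tsupport_subset⟩

theorem isTest_zero (U : Opens E) : IsTest U (fun _ => (0 : ℝ)) := isTest_coe (0 : 𝓓(U, ℝ))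

theorem IsTest.sum {U : Opens E} {ι : Type*} (s : Finset ι) {f : ι → E → ℝ}
    (hf : ∀ i ∈ s, IsTest U (f i)) : IsTest U (fun x => ∑ i ∈ s, f i x) := by
  classical
  induction s using Finset.induction_on with
  | empty => simpa using isTest_zero U
  | insert a s ha ih =>
    simp only [Finset.sum_insert ha]
    exact (hf a (by simp)).add (ih fun i hi => hf i (by simp [hi]))

theorem app_add {U : Opens E} (T : 𝓓'(U, ℝ)) {f g : E → ℝ} (hf : IsTest U f) (hg : IsTest U g) :
    app T (fun x => f x + g x) = app T f + app T g := by
  rw [app_eq T hf, app_eq T hg, app_eq T (hf.add hg), ← map_add]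
  rfl

theorem app_sub {U : Opens E} (T : 𝓓'(U, ℝ)) {f g : E → ℝ} (hf : IsTest U f) (hg : IsTest U g) :
    app T (fun x => f x - g x) = app T f - app T g := by
  rw [app_eq T hf, app_eq T hg, app_eq T (hf.sub hg), ← map_sub]
  rfl

theorem app_const_mul {U : Opens E} (T : 𝓓'(U, ℝ)) {f : E → ℝ} (hf : IsTest U f) (c : ℝ) :
    app T (fun x => c * f x) = c * app T f := by
  rw [app_eq T hf, app_eq T (hf.const_mul c), ← smul_eq_mul, ← map_smul]
  rfl

theorem app_zero {U : Opens E} (T : 𝓓'(U, ℝ)) : app T (fun _ => (0 : ℝ)) = 0 := by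
  rw [app_eq T (isTest_zero U)]
  exact map_zero T

theorem app_sum {U : Opens E} (T : 𝓓'(U, ℝ)) {ι : Type*} (s : Finset ι) {f : ι → E → ℝ}
    (hf : ∀ i ∈ s, IsTest U (f i)) : app T (fun x => ∑ i ∈ s, f i x) = ∑ i ∈ s, app T (f i) := by
  classical
  induction s using Finset.induction_on with
  | empty => simpa using app_zero T
  | insert a s ha ih =>
    simp only [Finset.sum_insert ha]
    rw [app_add T (hf a (by simp)) (IsTest.sum s fun i hi => hf i (by simp [hi])),
      ih fun i hi => hf i (by simp [hi])]

theorem app_sub_left {U : Opens E} (S T : 𝓓'(U, ℝ)) (f : E → ℝ) :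
    app (S - T) f = app S f - app T f := by
  unfold app
  split_ifs with h
  · rfl
  · simp

/-- `f` is a smooth function with support in `K`. -/
structure SmoothIn (K : Set E) (f : E → ℝ) : Prop where
  contDiff : ContDiff ℝ ∞ f
  tsupport_subset : tsupport f ⊆ K

theorem SmoothIn.isTest {K : Set E} {f : E → ℝ} (hf : SmoothIn K f) (hK : IsCompact K)
    {U : Opens E} (hU : K ⊆ U) : IsTest U f :=
  ⟨hf.contDiff, hK.of_isClosed_subset (isClosed_tsupport f) hf.tsupport_subset,
    hf.tsupport_subset.trans hU⟩

/-- `B` bounds all derivatives of `f` up to order `N`. -/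
def DerivBound (N : ℕ) (B : ℝ) (f : E → ℝ) : Prop :=
  ∀ i ≤ N, ∀ x, ‖iteratedFDeriv ℝ i f x‖ ≤ B

theorem DerivBound.nonneg {N : ℕ} {B : ℝ} {f : E → ℝ} (h : DerivBound N B f) : 0 ≤ B :=
  (norm_nonneg _).trans (h 0 (Nat.zero_le _) 0)

theorem DerivBound.mono {N N' : ℕ} {B : ℝ} {f : E → ℝ} (h : DerivBound N B f) (hN : N' ≤ N) :
    DerivBound N' B f := fun i hi => h i (hi.trans hN)

theorem exists_derivBound {f : E → ℝ} (hf : ContDiff ℝ ∞ f) (hc : HasCompactSupport f) (N : ℕ) :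
    ∃ B, DerivBound N B f := by
  have h : ∀ i, ∃ C, ∀ x, ‖iteratedFDeriv ℝ i f x‖ ≤ C := fun i =>
    (hf.continuous_iteratedFDeriv (m := i) (mod_cast le_top)).bounded_above_of_compact_support
      (hc.iteratedFDeriv i)
  choose C hC using h
  have hC0 : ∀ i, 0 ≤ C i := fun i => (norm_nonneg _).trans (hC i 0)
  refine ⟨∑ i ∈ Finset.range (N + 1), C i, fun i hi x => (hC i x).trans ?_⟩
  exact Finset.single_le_sum (f := C) (fun j _ => hC0 j) (Finset.mem_range.2 (by omega))

/-- `L` restricts to a continuous linear functional on the smooth functions supported in `K`. -/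
structure IsFunctional (K : Set E) (L : (E → ℝ) → ℝ) : Prop where
  add : ∀ f g, SmoothIn K f → SmoothIn K g → L (fun x => f x + g x) = L f + L g
  const_mul : ∀ (c : ℝ) f, SmoothIn K f → L (fun x => c * f x) = c * L f
  bound : ∃ C N, 0 ≤ C ∧ ∀ f, SmoothIn K f → ∀ B, DerivBound N B f → |L f| ≤ C * B

theorem smoothIn_coe {K : Compacts E} (φ : 𝓓_{K}(E, ℝ)) : SmoothIn (K : Set E) φ :=
  ⟨φ.contDiff, φ.tsupport_subset⟩

/-- The bundled function supported in `K` with underlying function `f`. -/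
noncomputable def SmoothIn.toSupportedIn {K : Compacts E} {f : E → ℝ} (hf : SmoothIn (K : Set E) f) :
    𝓓_{K}(E, ℝ) :=
  .of_support_subset hf.contDiff ((subset_tsupport f).trans hf.tsupport_subset)

theorem derivBound_seminorm {K : Compacts E} (N : ℕ) (φ : 𝓓_{K}(E, ℝ)) :
    DerivBound N (((Finset.range (N + 1)).sup
      fun i => ContDiffMapSupportedIn.seminorm ℝ E ℝ ⊤ K i) φ) φ := by
  intro i hi x
  refine (ContDiffMapSupportedIn.norm_iteratedFDeriv_apply_le_seminorm_top ℝ).trans ?_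
  exact Seminorm.le_finset_sup_apply (p := fun i => ContDiffMapSupportedIn.seminorm ℝ E ℝ ⊤ K i)
    (Finset.mem_range.2 (by omega))

/-- The continuous linear functional defined by `L`. -/
noncomputable def IsFunctional.toCLM {K : Compacts E} {L : (E → ℝ) → ℝ}
    (h : IsFunctional (K : Set E) L) : 𝓓_{K}(E, ℝ) →L[ℝ] ℝ :=
  ContDiffMapSupportedIn.mkCLMtoNormedSpace ℝ (fun φ => L φ)
    (fun φ ψ => h.add φ ψ (smoothIn_coe φ) (smoothIn_coe ψ))
    (fun c φ => h.const_mul c φ (smoothIn_coe φ)) (by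
      obtain ⟨C, N, hC, hb⟩ := h.bound
      exact ⟨Finset.range (N + 1), C, hC, fun φ =>
        hb φ (smoothIn_coe φ) _ (derivBound_seminorm N φ)⟩)

/-- The finitely many seminorms that control `p` are all dominated by a bound on derivatives up to
their maximal order. -/
theorem exists_bound_of_continuous_seminorm {K : Compacts E} {p : Seminorm ℝ 𝓓_{K}(E, ℝ)}
    (hp : Continuous p) : ∃ C N, 0 ≤ C ∧ ∀ (φ : 𝓓_{K}(E, ℝ)) B, DerivBound N B φ → p φ ≤ C * B := by
  obtain ⟨s, C, -, hC⟩ := Seminorm.bound_of_continuous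
    (ContDiffMapSupportedIn.withSeminorms ℝ E ℝ ⊤ K) p hp
  refine ⟨C, s.sup id, C.2, fun φ B hB => (hC φ).trans ?_⟩
  rw [_root_.smul_apply, NNReal.smul_def, smul_eq_mul]
  refine mul_le_mul_of_nonneg_left (Seminorm.finset_sup_apply_le hB.nonneg fun i hi => ?_) C.2
  rw [ContDiffMapSupportedIn.seminorm_top_le_iff ℝ hB.nonneg]
  exact fun x _ => hB i (Finset.le_sup (f := id) hi) x

theorem isFunctional_app {U : Opens E} (T : 𝓓'(U, ℝ)) (K : Compacts E) (hK : (K : Set E) ⊆ U) :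
    IsFunctional (K : Set E) (app T) where
  add f g hf hg := app_add T (hf.isTest K.isCompact hK) (hg.isTest K.isCompact hK)
  const_mul c f hf := app_const_mul T (hf.isTest K.isCompact hK) c
  bound := by
    have hcont : Continuous fun φ : 𝓓_{K}(E, ℝ) => T (TestFunction.ofSupportedIn hK φ) :=
      T.continuous.comp (TestFunction.continuous_ofSupportedIn hK)
    let A : 𝓓_{K}(E, ℝ) →ₗ[ℝ] ℝ :=
      (T : 𝓓(U, ℝ) →ₗ[ℝ] ℝ).comp (TestFunction.ofSupportedInCLM ℝ hK).toLinearMap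
    obtain ⟨C, N, hC, h⟩ := exists_bound_of_continuous_seminorm
      (p := (normSeminorm ℝ ℝ).comp A) (continuous_norm.comp hcont)
    refine ⟨C, N, hC, fun f hf B hB => ?_⟩
    have := h hf.toSupportedIn B hB
    rw [app_eq T (hf.isTest K.isCompact hK)]
    exact this

/-- The **Banach-Steinhaus** theorem for functionals on smooth functions supported in `K`. -/
theorem exists_uniform_bound {ι : Type*} (K : Compacts E) {L : ι → (E → ℝ) → ℝ}
    (hL : ∀ i, IsFunctional (K : Set E) (L i))
    (hpt : ∀ f, SmoothIn (K : Set E) f → ∃ M, ∀ i, |L i f| ≤ M) :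
    ∃ C N, 0 ≤ C ∧ ∀ i f, SmoothIn (K : Set E) f → ∀ B, DerivBound N B f → |L i f| ≤ C * B := by
  have hbdd : BddAbove (Set.range fun i => (normSeminorm ℝ ℝ).comp (hL i).toCLM.toLinearMap) := by
    rw [Seminorm.bddAbove_range_iff]
    intro φ
    obtain ⟨M, hM⟩ := hpt φ (smoothIn_coe φ)
    exact ⟨M, by rintro _ ⟨i, rfl⟩; exact hM i⟩
  -- A pointwise bounded supremum of continuous seminorms is continuous, by the Baire property.
  have hcont : Continuous (⨆ i, (normSeminorm ℝ ℝ).comp (hL i).toCLM.toLinearMap) := by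
    exact Seminorm.continuous_iSup (𝕜 := ℝ) (fun i => (normSeminorm ℝ ℝ).comp (hL i).toCLM.toLinearMap)
      (fun i => continuous_norm.comp (hL i).toCLM.continuous) hbdd
  rw [← Seminorm.coe_iSup_eq hbdd] at hcont
  obtain ⟨C, N, hC, h⟩ := exists_bound_of_continuous_seminorm hcont
  refine ⟨C, N, hC, fun i f hf B hB => ?_⟩
  refine le_trans ?_ (h hf.toSupportedIn B hB)
  exact (le_ciSup hbdd i : (normSeminorm ℝ ℝ).comp (hL i).toCLM.toLinearMap ≤ _) hf.toSupportedIn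

/-- A convergent sequence is pointwise bounded, so the uniform bound passes to the limit. This gives
the continuity of the extension. -/
theorem IsFunctional.of_tendsto (K : Compacts E) {L : ℕ → (E → ℝ) → ℝ} {L' : (E → ℝ) → ℝ}
    (hL : ∀ i, IsFunctional (K : Set E) (L i))
    (hlim : ∀ f, SmoothIn (K : Set E) f → Tendsto (fun i => L i f) atTop (𝓝 (L' f))) :
    IsFunctional (K : Set E) L' where
  add f g hf hg := by
    refine tendsto_nhds_unique (hlim _ ⟨hf.contDiff.add hg.contDiff,
      (tsupport_add f g).trans (Set.union_subset hf.tsupport_subset hg.tsupport_subset)⟩) ?_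
    simp_rw [fun i => (hL i).add f g hf hg]
    exact (hlim f hf).add (hlim g hg)
  const_mul c f hf := by
    refine tendsto_nhds_unique (hlim _ ⟨contDiff_const.mul hf.contDiff,
      (tsupport_mul_subset_right (f := fun _ => c)).trans hf.tsupport_subset⟩) ?_
    simp_rw [fun i => (hL i).const_mul c f hf]
    exact (hlim f hf).const_mul c
  bound := by
    obtain ⟨C, N, hC, h⟩ := exists_uniform_bound K hL fun f hf => by
      obtain ⟨M, hM⟩ := (hlim f hf).norm.bddAbove_range
      exact ⟨M, fun i => hM ⟨i, rfl⟩⟩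
    exact ⟨C, N, hC, fun f hf B hB =>
      le_of_tendsto (hlim f hf).norm (Eventually.of_forall fun i => h i f hf B hB)⟩

/-- Continuity on test functions is tested on each compact support; any two test functions share a
compact set, which gives linearity. -/
theorem exists_distribution {U : Opens E} {L : (E → ℝ) → ℝ}
    (h : ∀ K : Compacts E, (K : Set E) ⊆ U → IsFunctional (K : Set E) L) :
    ∃ T : 𝓓'(U, ℝ), ∀ f, IsTest U f → app T f = L f := by
  have key : ∀ φ : 𝓓(U, ℝ), ∀ ψ : 𝓓(U, ℝ), ∃ K : Compacts E, (K : Set E) ⊆ U ∧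
      SmoothIn (K : Set E) φ ∧ SmoothIn (K : Set E) ψ := fun φ ψ =>
    ⟨⟨tsupport φ ∪ tsupport ψ, φ.hasCompactSupport.union ψ.hasCompactSupport⟩,
      Set.union_subset φ.tsupport_subset ψ.tsupport_subset,
      ⟨φ.contDiff, Set.subset_union_left⟩, ⟨ψ.contDiff, Set.subset_union_right⟩⟩
  refine ⟨TestFunction.mkCLM ℝ (fun φ => L φ) (fun φ ψ => ?_) (fun c φ => ?_) (fun K hK => ?_),
    fun f hf => ?_⟩
  · obtain ⟨K, hK, h1, h2⟩ := key φ ψ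
    exact (h K hK).add φ ψ h1 h2
  · obtain ⟨K, hK, h1, -⟩ := key φ φ
    exact (h K hK).const_mul c φ h1
  · exact (h K hK).toCLM.continuous
  · exact app_eq (U := U) _ hf

theorem IsFunctional.finset_sum {K : Set E} {ι : Type*} (s : Finset ι) {L : ι → (E → ℝ) → ℝ}
    (h : ∀ i ∈ s, IsFunctional K (L i)) : IsFunctional K (fun f => ∑ i ∈ s, L i f) where
  add f g hf hg := by
    rw [← Finset.sum_add_distrib]
    exact Finset.sum_congr rfl fun i hi => (h i hi).add f g hf hg
  const_mul c f hf := by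
    rw [Finset.mul_sum]
    exact Finset.sum_congr rfl fun i hi => (h i hi).const_mul c f hf
  bound := by
    classical
    choose! C N hC hb using fun i (hi : i ∈ s) => (h i hi).bound
    refine ⟨∑ i ∈ s, C i, s.sup N, Finset.sum_nonneg hC, fun f hf B hB => ?_⟩
    refine (Finset.abs_sum_le_sum_abs _ _).trans ?_
    rw [Finset.sum_mul]
    exact Finset.sum_le_sum fun i hi => hb i hi f hf B (hB.mono (Finset.le_sup hi))

theorem IsFunctional.add_functional {K : Set E} {L L' : (E → ℝ) → ℝ} (h : IsFunctional K L)
    (h' : IsFunctional K L') : IsFunctional K (fun f => L f + L' f) := by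
  have := IsFunctional.finset_sum (K := K) (L := fun b : Bool => if b then L else L') Finset.univ
    (by rintro (_ | _) -; exacts [h', h])
  simpa using this

theorem IsFunctional.const_mul_functional {K : Set E} {L : (E → ℝ) → ℝ} (h : IsFunctional K L)
    (c : ℝ) : IsFunctional K (fun f => c * L f) where
  add f g hf hg := by rw [h.add f g hf hg, mul_add]
  const_mul a f hf := by rw [h.const_mul a f hf]; ring
  bound := by
    obtain ⟨C, N, hC, hb⟩ := h.bound
    refine ⟨|c| * C, N, by positivity, fun f hf B hB => ?_⟩
    rw [abs_mul, mul_assoc]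
    exact mul_le_mul_of_nonneg_left (hb f hf B hB) (abs_nonneg c)

theorem SmoothIn.mul {K K' : Set E} {f g : E → ℝ} (hf : SmoothIn K f) (hg : SmoothIn K' g) :
    SmoothIn (K ∩ K') (fun x => f x * g x) :=
  ⟨hf.contDiff.mul hg.contDiff, Set.subset_inter
    ((tsupport_mul_subset_left (f := f)).trans hf.tsupport_subset)
    ((tsupport_mul_subset_right (f := f)).trans hg.tsupport_subset)⟩

theorem norm_iteratedFDeriv_mul_le_of_le {f g : E → ℝ} (hg : ContDiff ℝ ∞ g)
    (hf : ContDiff ℝ ∞ f) {x : E} {N : ℕ} {A B : ℝ} (hA : ∀ i ≤ N, ‖iteratedFDeriv ℝ i g x‖ ≤ A)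
    (hB : ∀ i ≤ N, ‖iteratedFDeriv ℝ i f x‖ ≤ B) {i : ℕ} (hi : i ≤ N) :
    ‖iteratedFDeriv ℝ i (fun y => g y * f y) x‖ ≤ 2 ^ N * A * B := by
  have hA0 : 0 ≤ A := (norm_nonneg _).trans (hA 0 (Nat.zero_le _))
  have hB0 : 0 ≤ B := (norm_nonneg _).trans (hB 0 (Nat.zero_le _))
  refine (norm_iteratedFDeriv_mul_le hg hf x (n := i) (mod_cast le_top)).trans ?_
  calc ∑ l ∈ Finset.range (i + 1), (i.choose l : ℝ) * ‖iteratedFDeriv ℝ l g x‖ *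
        ‖iteratedFDeriv ℝ (i - l) f x‖
      ≤ ∑ l ∈ Finset.range (i + 1), (i.choose l : ℝ) * A * B := by
        refine Finset.sum_le_sum fun l hl => ?_
        have hl' : l ≤ i := by simpa [Nat.lt_succ_iff] using hl
        gcongr
        · exact hA l (hl'.trans hi)
        · exact hB (i - l) (by omega)
    _ = 2 ^ i * A * B := by
        rw [← Finset.sum_mul, ← Finset.sum_mul, ← Nat.cast_sum, Nat.sum_range_choose]
        push_cast; ring
    _ ≤ 2 ^ N * A * B := by
        gcongr
        norm_num

/-- Multiplication by a compactly supported smooth function controls derivatives. -/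
theorem exists_derivBound_mul {g : E → ℝ} (hg : ContDiff ℝ ∞ g) (hc : HasCompactSupport g)
    (N : ℕ) : ∃ C, 0 ≤ C ∧ ∀ f : E → ℝ, ContDiff ℝ ∞ f → ∀ B, 0 ≤ B →
      (∀ i ≤ N, ∀ x ∈ tsupport g, ‖iteratedFDeriv ℝ i f x‖ ≤ B) →
      DerivBound N (C * B) (fun x => g x * f x) := by
  obtain ⟨A, hA⟩ := exists_derivBound hg hc N
  have hA0 := hA.nonneg
  refine ⟨2 ^ N * A, by positivity, fun f hf B hB h i hi x => ?_⟩
  by_cases hx : x ∈ tsupport g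
  · exact norm_iteratedFDeriv_mul_le_of_le hg hf (fun i hi => hA i hi x) (fun i hi => h i hi x hx) hi
  · have : x ∉ tsupport fun x => g x * f x := fun h' => hx (tsupport_mul_subset_left (f := g) h')
    rw [Function.notMem_support.1 fun h' => this (support_iteratedFDeriv_subset i h'), norm_zero]
    positivity

/-- Precomposing with multiplication by a smooth function. -/
theorem IsFunctional.comp_mul {K K' : Set E} {L : (E → ℝ) → ℝ} (h : IsFunctional K' L)
    (hKc : IsCompact K) {g : E → ℝ} (hg : ContDiff ℝ ∞ g) (hK : tsupport g ∩ K ⊆ K') :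
    IsFunctional K (fun f => L (fun x => g x * f x)) := by
  have hs : ∀ f, SmoothIn K f → SmoothIn K' (fun x => g x * f x) := fun f hf =>
    have := SmoothIn.mul (⟨hg, subset_rfl⟩ : SmoothIn (tsupport g) g) hf
    ⟨this.contDiff, this.tsupport_subset.trans hK⟩
  refine ⟨fun f₁ f₂ h₁ h₂ => ?_, fun c f hf => ?_, ?_⟩
  · simp_rw [mul_add]
    exact h.add _ _ (hs _ h₁) (hs _ h₂)
  · simp_rw [mul_left_comm _ c]
    exact h.const_mul c _ (hs _ hf)
  · obtain ⟨C, N, hC, hb⟩ := h.bound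
    -- Here `g` need not have compact support: bounds on its derivatives over `K` suffice, as the
    -- product vanishes off `K`.
    choose A hA using fun i => hKc.exists_bound_of_continuousOn
      (hg.continuous_iteratedFDeriv (m := i) (mod_cast le_top)).continuousOn
    set A' := ∑ i ∈ Finset.range (N + 1), |A i| with hA'
    have hA0 : 0 ≤ A' := Finset.sum_nonneg fun i _ => abs_nonneg _
    have hle : ∀ i ≤ N, ∀ x ∈ K, ‖iteratedFDeriv ℝ i g x‖ ≤ A' := fun i hi x hx =>
      ((hA i x hx).trans (le_abs_self _)).trans (Finset.single_le_sum (f := fun i => |A i|)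
        (fun j _ => abs_nonneg _) (Finset.mem_range.2 (by omega)))
    refine ⟨C * (2 ^ N * A'), N, by positivity, fun f hf B hB => ?_⟩
    rw [mul_assoc]
    refine hb _ (hs f hf) _ fun i hi x => ?_
    by_cases hx : x ∈ K
    · exact norm_iteratedFDeriv_mul_le_of_le hg hf.contDiff (fun i hi => hle i hi x hx)
        (fun i hi => hB i hi x) hi
    · have : x ∉ tsupport fun x => g x * f x := fun h' =>
        hx (hf.tsupport_subset (tsupport_mul_subset_right (f := g) h'))
      rw [Function.notMem_support.1 fun h' => this (support_iteratedFDeriv_subset i h'), norm_zero]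
      have := hB.nonneg
      positivity

theorem IsFunctional.congr {K : Set E} {L L' : (E → ℝ) → ℝ} (h : IsFunctional K L)
    (hLL' : ∀ f, SmoothIn K f → L' f = L f) : IsFunctional K L' where
  add f g hf hg := by
    rw [hLL' _ hf, hLL' _ hg, hLL' _ ⟨hf.contDiff.add hg.contDiff,
      (tsupport_add f g).trans (Set.union_subset hf.tsupport_subset hg.tsupport_subset)⟩,
      h.add f g hf hg]
  const_mul c f hf := by
    rw [hLL' _ hf, hLL' _ ⟨contDiff_const.mul hf.contDiff,
      (tsupport_mul_subset_right (f := fun _ => c)).trans hf.tsupport_subset⟩,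
      h.const_mul c f hf]
  bound := by
    obtain ⟨C, N, hC, hb⟩ := h.bound
    exact ⟨C, N, hC, fun f hf B hB => by rw [hLL' f hf]; exact hb f hf B hB⟩

theorem isFunctional_iteratedFDeriv (K : Set E) (x : E) {i : ℕ} (v : Fin i → E) :
    IsFunctional K (fun f => iteratedFDeriv ℝ i f x v) where
  add f g hf hg := by
    have := iteratedFDeriv_add_apply (x := x) (i := i) (f := f) (g := g) (𝕜 := ℝ)
      (hf.contDiff.of_le (mod_cast le_top)).contDiffAt
      (hg.contDiff.of_le (mod_cast le_top)).contDiffAt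
    exact congrArg (fun M => M v) this
  const_mul c f hf := by
    have := iteratedFDeriv_const_smul_apply (x := x) (i := i) (f := f) (𝕜 := ℝ) (a := c)
      (hf.contDiff.of_le (mod_cast le_top)).contDiffAt
    exact congrArg (fun M => M v) this
  bound := ⟨∏ j, ‖v j‖, i, Finset.prod_nonneg fun j _ => norm_nonneg _, fun f _ B hB => by
    refine ((iteratedFDeriv ℝ i f x).le_opNorm v).trans ?_
    rw [mul_comm]
    exact mul_le_mul_of_nonneg_left (hB i le_rfl x) (Finset.prod_nonneg fun j _ => norm_nonneg _)⟩

end Functionals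

/-! ### Taylor polynomials and remainders at the origin. -/

section Calculus

variable {E : Type*} [NormedAddCommGroup E] [NormedSpace ℝ E]

theorem iteratedFDeriv_comp_smul {f : E → ℝ} (hf : ContDiff ℝ ∞ f) (c : ℝ) (i : ℕ) (x : E) :
    iteratedFDeriv ℝ i (fun x => f (c • x)) x = c ^ i • iteratedFDeriv ℝ i f (c • x) := by
  have := (c • ContinuousLinearMap.id ℝ E).iteratedFDeriv_comp_right hf x (i := i)
    (mod_cast le_top)
  ext v
  have h2 := congrArg (fun M => M v) this
  simp only [ContinuousMultilinearMap.compContinuousLinearMap_apply] at h2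
  refine h2.trans ?_
  simp [ContinuousMultilinearMap.map_smul_univ]

theorem contDiff_comp_smul {f : E → ℝ} (hf : ContDiff ℝ ∞ f) (c : ℝ) :
    ContDiff ℝ ∞ (fun x => f (c • x)) := hf.comp (contDiff_const_smul c)

/-- The iterated derivative along the vectors of a list. -/
noncomputable def listDeriv (l : List E) (f : E → ℝ) : E → ℝ :=
  l.foldr (fun v g x => fderiv ℝ g x v) f

theorem contDiff_fderiv_apply {f : E → ℝ} (hf : ContDiff ℝ ∞ f) (v : E) :
    ContDiff ℝ ∞ (fun x => fderiv ℝ f x v) :=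
  (hf.fderiv_right (m := ∞) (by norm_num)).clm_apply contDiff_const

theorem contDiff_listDeriv {f : E → ℝ} (hf : ContDiff ℝ ∞ f) (l : List E) :
    ContDiff ℝ ∞ (listDeriv l f) := by
  induction l with
  | nil => exact hf
  | cons v l ih => exact contDiff_fderiv_apply ih v

theorem fderiv_fderiv_comm {f : E → ℝ} (hf : ContDiff ℝ ∞ f) (v w : E) :
    (fun x => fderiv ℝ (fun y => fderiv ℝ f y v) x w) =
      fun x => fderiv ℝ (fun y => fderiv ℝ f y w) x v := by
  funext x
  have hd : DifferentiableAt ℝ (fderiv ℝ f) x :=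
    ((hf.fderiv_right (m := ∞) (by norm_num)).differentiable (by norm_num)).differentiableAt
  rw [fderiv_clm_apply hd (differentiableAt_const v), fderiv_clm_apply hd (differentiableAt_const w)]
  simp only [fderiv_fun_const, Pi.zero_apply, ContinuousLinearMap.comp_zero, zero_add,
    ContinuousLinearMap.flip_apply]
  exact (hf.contDiffAt.isSymmSndFDerivAt (by simp; exact WithTop.coe_le_coe.2 le_top)).eq w v

/-- Adjacent swaps are Schwarz's theorem, and they generate all permutations. It serves both the
symmetry of iterated derivatives and the ordering of multi-indices. -/
theorem listDeriv_perm {f : E → ℝ} (hf : ContDiff ℝ ∞ f) {l l' : List E} (h : l.Perm l') :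
    listDeriv l f = listDeriv l' f := by
  induction h with
  | nil => rfl
  | cons v _ ih => exact congrArg (fun g : E → ℝ => fun x => fderiv ℝ g x v) ih
  | swap v w l => exact fderiv_fderiv_comm (contDiff_listDeriv hf l) v w
  | trans _ _ h1 h2 => exact h1.trans h2

theorem iteratedFDeriv_eq_listDeriv {f : E → ℝ} (hf : ContDiff ℝ ∞ f) {i : ℕ} (v : Fin i → E)
    (x : E) : iteratedFDeriv ℝ i f x v = listDeriv (List.ofFn v) f x := by
  induction i generalizing x with
  | zero => simp [listDeriv]
  | succ i ih =>
    rw [iteratedFDeriv_succ_apply_left, List.ofFn_succ]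
    change _ = fderiv ℝ (listDeriv (List.ofFn fun j : Fin i => v j.succ) f) x (v 0)
    rw [← funext fun y => ih (fun j => v j.succ) y]
    have hd : DifferentiableAt ℝ (iteratedFDeriv ℝ i f) x :=
      (hf.differentiable_iteratedFDeriv (m := i) (WithTop.coe_lt_coe.2 (ENat.natCast_lt_top i))) x
    have := ((ContinuousMultilinearMap.apply ℝ (fun _ : Fin i => E) ℝ
      (fun j => v j.succ)).hasFDerivAt.comp x hd.hasFDerivAt).fderiv
    rw [show (fun y => iteratedFDeriv ℝ i f y fun j => v j.succ) =
      (ContinuousMultilinearMap.apply ℝ (fun _ : Fin i => E) ℝ (fun j => v j.succ)) ∘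
        iteratedFDeriv ℝ i f from rfl, this]
    rfl

theorem iteratedFDeriv_comp_perm {f : E → ℝ} (hf : ContDiff ℝ ∞ f) {i : ℕ} (v : Fin i → E)
    (x : E) (σ : Equiv.Perm (Fin i)) :
    iteratedFDeriv ℝ i f x (fun j => v (σ j)) = iteratedFDeriv ℝ i f x v := by
  rw [iteratedFDeriv_eq_listDeriv hf, iteratedFDeriv_eq_listDeriv hf]
  exact congrFun (listDeriv_perm hf (Equiv.Perm.ofFn_comp_perm σ v)) x

/-- The Taylor polynomial at `0` of degree less than `m`. -/
noncomputable def taylorPoly (m : ℕ) (f : E → ℝ) (x : E) : ℝ :=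
  ∑ j ∈ Finset.range m, (j.factorial : ℝ)⁻¹ * iteratedFDeriv ℝ j f 0 (fun _ => x)

theorem contDiff_taylorTerm (f : E → ℝ) (j : ℕ) :
    ContDiff ℝ ∞ (fun x => (j.factorial : ℝ)⁻¹ * iteratedFDeriv ℝ j f 0 (fun _ => x)) :=
  contDiff_const.mul ((iteratedFDeriv ℝ j f 0).contDiff.comp (contDiff_pi.2 fun _ => contDiff_id))

theorem contDiff_taylorPoly (m : ℕ) (f : E → ℝ) : ContDiff ℝ ∞ (taylorPoly m f) :=
  ContDiff.sum fun j _ => contDiff_taylorTerm f j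

theorem taylorTerm_smul (f : E → ℝ) (j : ℕ) (c : ℝ) (x : E) :
    (j.factorial : ℝ)⁻¹ * iteratedFDeriv ℝ j f 0 (fun _ => c • x) =
      c ^ j * ((j.factorial : ℝ)⁻¹ * iteratedFDeriv ℝ j f 0 (fun _ => x)) := by
  have := (iteratedFDeriv ℝ j f 0).map_smul_univ (fun _ => c) (fun _ => x)
  rw [this]
  simp only [Finset.prod_const, Finset.card_univ, Fintype.card_fin, smul_eq_mul]
  ring

/-- Taylor expansion at the fixed point of the dilation commutes with it; this lets remainders of
rescaled functions be estimated by rescaling remainders. -/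
theorem taylorPoly_comp_smul {f : E → ℝ} (hf : ContDiff ℝ ∞ f) (m : ℕ) (a c : ℝ) (x : E) :
    taylorPoly m (fun x => a * f (c • x)) x = a * taylorPoly m f (c • x) := by
  unfold taylorPoly
  rw [Finset.mul_sum]
  refine Finset.sum_congr rfl fun j _ => ?_
  have h1 : iteratedFDeriv ℝ j (fun x => a * f (c • x)) 0 =
      a • iteratedFDeriv ℝ j (fun x => f (c • x)) 0 :=
    iteratedFDeriv_const_smul_apply' (f := fun x => f (c • x)) (a := a) (𝕜 := ℝ)
      ((contDiff_comp_smul hf c).of_le (mod_cast le_top)).contDiffAt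
  rw [h1, iteratedFDeriv_comp_smul hf, smul_zero, taylorTerm_smul]
  simp only [_root_.smul_apply, smul_eq_mul]
  ring

theorem taylorPoly_eq_zero {f : E → ℝ} (hf : f =ᶠ[𝓝 0] fun _ => 0) (m : ℕ) :
    taylorPoly m f = fun _ => 0 := by
  funext x
  refine Finset.sum_eq_zero fun j _ => ?_
  rw [(hf.iteratedFDeriv ℝ j).eq_of_nhds]
  simp

theorem iteratedFDeriv_taylorPoly {f : E → ℝ} (hf : ContDiff ℝ ∞ f) {m i : ℕ} (hi : i < m) :
    iteratedFDeriv ℝ i (taylorPoly m f) 0 = iteratedFDeriv ℝ i f 0 := by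
  let p : FormalMultilinearSeries ℝ E ℝ := fun j =>
    if j < m then (j.factorial : ℝ)⁻¹ • iteratedFDeriv ℝ j f 0 else 0
  have hp : HasFiniteFPowerSeriesOnBall (taylorPoly m f) p 0 m ⊤ := by
    refine HasFiniteFPowerSeriesOnBall.mk' (fun j hj => if_neg (by omega)) (by simp)
      fun y _ => ?_
    rw [zero_add]
    refine Finset.sum_congr rfl fun j hj => ?_
    simp only [p, if_pos (Finset.mem_range.1 hj)]
    rfl
  ext v
  rw [hp.toHasFPowerSeriesOnBall.iteratedFDeriv_eq_sum_of_completeSpace]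
  -- The derivative of the power series is a sum over permutations; by symmetry its `i!` terms agree
  -- and cancel the factorial.
  have h1 : ∀ σ : Equiv.Perm (Fin i), p i (fun j => v (σ j)) =
      (i.factorial : ℝ)⁻¹ * iteratedFDeriv ℝ i f 0 v := by
    intro σ
    simp only [p, if_pos hi]
    rw [← iteratedFDeriv_comp_perm hf v 0 σ]
    rfl
  simp_rw [h1]
  rw [Finset.sum_const, Finset.card_univ, Fintype.card_perm, Fintype.card_fin, nsmul_eq_mul,
    mul_inv_cancel_left₀ (by positivity)]

/-- The Taylor remainder at `0`. -/
noncomputable def taylorRem (m : ℕ) (f : E → ℝ) (x : E) : ℝ := f x - taylorPoly m f x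

theorem contDiff_taylorRem {f : E → ℝ} (hf : ContDiff ℝ ∞ f) (m : ℕ) :
    ContDiff ℝ ∞ (taylorRem m f) := hf.sub (contDiff_taylorPoly m f)

theorem iteratedFDeriv_taylorRem {f : E → ℝ} (hf : ContDiff ℝ ∞ f) {m i : ℕ} (hi : i < m) :
    iteratedFDeriv ℝ i (taylorRem m f) 0 = 0 := by
  have := iteratedFDeriv_sub_apply (x := (0 : E)) (i := i) (f := f) (g := taylorPoly m f)
    (hf.of_le (mod_cast le_top)).contDiffAt
    ((contDiff_taylorPoly m f).of_le (mod_cast le_top)).contDiffAt (𝕜 := ℝ)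
  exact this.trans (by rw [iteratedFDeriv_taylorPoly hf hi, sub_self])

theorem exists_bound_on_closedBall [ProperSpace E] {f : E → ℝ} (hf : ContDiff ℝ ∞ f) (ρ : ℝ)
    (i : ℕ) : ∃ C, 0 ≤ C ∧ ∀ y, ‖y‖ ≤ ρ → ‖iteratedFDeriv ℝ i f y‖ ≤ C := by
  obtain ⟨C, hC⟩ := (isCompact_closedBall (0 : E) ρ).exists_bound_of_continuousOn
    (hf.continuous_iteratedFDeriv (m := i) (mod_cast le_top)).continuousOn
  exact ⟨|C|, abs_nonneg C, fun y hy =>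
    (hC y (mem_closedBall_zero_iff.2 hy)).trans (le_abs_self C)⟩

/-- Descending induction on the order: a bound for the derivative of order `i + 1` integrates, by
the mean value inequality on the ball of radius `‖y‖`, to one power of `‖y‖` more at order `i`. -/
theorem exists_bound_of_jet_eq_zero_aux [ProperSpace E] {f : E → ℝ} (hf : ContDiff ℝ ∞ f) {m : ℕ}
    (h0 : ∀ i < m, iteratedFDeriv ℝ i f 0 = 0) (ρ : ℝ) (i : ℕ) :
    ∃ C, 0 ≤ C ∧ ∀ y, ‖y‖ ≤ ρ → ‖iteratedFDeriv ℝ i f y‖ ≤ C * ‖y‖ ^ (m - i) := by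
  induction hd : m - i generalizing i with
  | zero => simpa using exists_bound_on_closedBall hf ρ i
  | succ d ih =>
    obtain ⟨C, hC, h⟩ := ih (i + 1) (by omega)
    refine ⟨C, hC, fun y hy => ?_⟩
    have := (convex_closedBall (0 : E) ‖y‖).norm_image_sub_le_of_norm_fderiv_le (𝕜 := ℝ)
      (f := iteratedFDeriv ℝ i f) (C := C * ‖y‖ ^ d) (x := 0) (y := y)
      (fun z _ => (hf.differentiable_iteratedFDeriv (m := i)
        (WithTop.coe_lt_coe.2 (ENat.natCast_lt_top i))) z)
      (fun z hz => ?_) (by simp) (by simp)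
    · rw [h0 i (by omega), sub_zero, sub_zero, mul_assoc, ← pow_succ] at this
      exact this
    · rw [mem_closedBall_zero_iff] at hz
      rw [norm_fderiv_iteratedFDeriv]
      refine (h z (hz.trans hy)).trans ?_
      gcongr

/-- A smooth function whose derivatives of order less than `m` vanish at `0`, rescaled. -/
theorem exists_bound_of_jet_eq_zero [ProperSpace E] {f : E → ℝ} (hf : ContDiff ℝ ∞ f) {m : ℕ}
    (h0 : ∀ i < m, iteratedFDeriv ℝ i f 0 = 0) (ρ : ℝ) (N : ℕ) :
    ∃ C, 0 ≤ C ∧ ∀ u, 0 < u → u ≤ 1 → ∀ i ≤ N, ∀ x, ‖x‖ ≤ ρ →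
      ‖iteratedFDeriv ℝ i (fun x => f (u • x)) x‖ ≤ C * u ^ m := by
  choose C hC h using exists_bound_of_jet_eq_zero_aux hf h0 ρ
  refine ⟨∑ i ∈ Finset.range (N + 1), C i * |ρ| ^ (m - i), Finset.sum_nonneg fun i _ =>
    mul_nonneg (hC i) (by positivity), fun u hu hu1 i hi x hx => ?_⟩
  have hρ : 0 ≤ ρ := (norm_nonneg x).trans hx
  have h1 : ‖u • x‖ ≤ ρ := by
    rw [norm_smul, Real.norm_of_nonneg hu.le]
    exact (mul_le_of_le_one_left (norm_nonneg x) hu1).trans hx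
  rw [iteratedFDeriv_comp_smul hf, norm_smul, norm_pow, Real.norm_of_nonneg hu.le]
  calc u ^ i * ‖iteratedFDeriv ℝ i f (u • x)‖
      ≤ u ^ i * (C i * (u * |ρ|) ^ (m - i)) := by
        have h2 : ‖u • x‖ ≤ u * |ρ| := by
          rw [norm_smul, Real.norm_of_nonneg hu.le, abs_of_nonneg hρ]
          gcongr
        have := hC i
        refine mul_le_mul_of_nonneg_left ((h i _ h1).trans ?_) (by positivity)
        gcongr
    _ = (C i * |ρ| ^ (m - i)) * u ^ (i + (m - i)) := by rw [mul_pow, pow_add]; ring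
    _ ≤ (∑ i ∈ Finset.range (N + 1), C i * |ρ| ^ (m - i)) * u ^ m := by
        refine mul_le_mul ?_ (pow_le_pow_of_le_one hu.le hu1 (by omega)) (by positivity)
          (Finset.sum_nonneg fun i _ => mul_nonneg (hC i) (by positivity))
        exact Finset.single_le_sum (f := fun i => C i * |ρ| ^ (m - i))
          (fun j _ => mul_nonneg (hC j) (by positivity)) (Finset.mem_range.2 (by omega))

/-- Bound on the rescaled Taylor remainder on an annulus, for contractions and for dilations. -/
theorem exists_bound_taylorRem [ProperSpace E] {f : E → ℝ} (hf : ContDiff ℝ ∞ f)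
    (hc : HasCompactSupport f) {ρ₀ ρ₁ : ℝ} (hρ₀ : 0 < ρ₀) {m q : ℕ} (hq : m = 0 ∨ q ≤ 1) (N : ℕ) :
    ∃ C, 0 ≤ C ∧ ∀ u, 0 < u → ∀ i ≤ N, ∀ x, ρ₀ ≤ ‖x‖ → ‖x‖ ≤ ρ₁ →
      ‖iteratedFDeriv ℝ i (fun x => taylorRem m f (u • x)) x‖ ≤ C * (u ^ m * min 1 (u ^ q)⁻¹) := by
  obtain ⟨C₁, hC₁, h₁⟩ := exists_bound_of_jet_eq_zero (contDiff_taylorRem hf m)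
    (fun i hi => iteratedFDeriv_taylorRem hf hi) ρ₁ N
  obtain ⟨B, hB⟩ := exists_derivBound hf hc N
  obtain ⟨ρ₂, hρ₂⟩ := hc.isCompact.isBounded.subset_closedBall (0 : E)
  choose A hA hA' using fun j i => exists_bound_on_closedBall (contDiff_taylorTerm f j) ρ₁ i
  -- A dilation factor beyond `v` moves the annulus out of the support of `f`, leaving only the
  -- Taylor polynomial.
  set v := max 1 (ρ₂ / ρ₀) with hv
  set S := ∑ i ∈ Finset.range (N + 1), ∑ j ∈ Finset.range m, A j i with hS
  have hv1 : 1 ≤ v := le_max_left _ _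
  have hS0 : 0 ≤ S := Finset.sum_nonneg fun i _ => Finset.sum_nonneg fun j _ => hA j i
  have hB0 := hB.nonneg
  refine ⟨C₁ + v ^ (N + q) * B + S, by positivity, fun u hu i hi x hx₀ hx₁ => ?_⟩
  have hmin : 0 ≤ min 1 (u ^ q)⁻¹ := by positivity
  rcases le_total u 1 with hu1 | hu1
  · refine (h₁ u hu hu1 i hi x hx₁).trans ?_
    have h1 : min 1 (u ^ q)⁻¹ = 1 :=
      min_eq_left ((one_le_inv₀ (by positivity)).2 (pow_le_one₀ hu.le hu1))
    rw [h1, mul_one]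
    gcongr
    linarith [show 0 ≤ v ^ (N + q) * B by positivity]
  · have h1 : min 1 (u ^ q)⁻¹ = (u ^ q)⁻¹ := min_eq_right (inv_le_one_of_one_le₀ (one_le_pow₀ hu1))
    rw [h1]
    have hfun : (fun x => taylorRem m f (u • x)) = fun x => f (u • x) - taylorPoly m f (u • x) := rfl
    have hsub := iteratedFDeriv_sub_apply (x := x) (i := i) (f := fun x => f (u • x))
      (g := fun x => taylorPoly m f (u • x)) (𝕜 := ℝ)
      ((contDiff_comp_smul hf u).of_le (mod_cast le_top)).contDiffAt
      ((contDiff_comp_smul (contDiff_taylorPoly m f) u).of_le (mod_cast le_top)).contDiffAt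
    rw [hfun, show (fun x => f (u • x) - taylorPoly m f (u • x)) =
      (fun x => f (u • x)) - fun x => taylorPoly m f (u • x) from rfl, hsub]
    have hf1 : ‖iteratedFDeriv ℝ i (fun x => f (u • x)) x‖ ≤ v ^ (N + q) * B * (u ^ m * (u ^ q)⁻¹) := by
      rw [iteratedFDeriv_comp_smul hf, norm_smul, norm_pow, Real.norm_of_nonneg hu.le]
      by_cases hux : u • x ∈ tsupport f
      · have h2 : u ≤ v := by
          have h3 := mem_closedBall_zero_iff.1 (hρ₂ hux)
          rw [norm_smul, Real.norm_of_nonneg hu.le] at h3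
          refine le_trans ?_ (le_max_right _ _)
          rw [le_div_iff₀ hρ₀]
          exact (mul_le_mul_of_nonneg_left hx₀ hu.le).trans h3
        have h4 : u ^ i * u ^ q ≤ v ^ (N + q) * u ^ m := by
          rw [← pow_add]
          calc u ^ (i + q) ≤ v ^ (i + q) := by gcongr
            _ ≤ v ^ (N + q) := pow_le_pow_right₀ hv1 (by omega)
            _ ≤ v ^ (N + q) * u ^ m := le_mul_of_one_le_right (by positivity) (one_le_pow₀ hu1)
        have h5 : u ^ i ≤ v ^ (N + q) * (u ^ m * (u ^ q)⁻¹) := by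
          rw [← mul_assoc, ← div_eq_mul_inv, le_div_iff₀ (by positivity)]
          exact h4
        calc u ^ i * ‖iteratedFDeriv ℝ i f (u • x)‖
            ≤ (v ^ (N + q) * (u ^ m * (u ^ q)⁻¹)) * B :=
              mul_le_mul h5 (hB i hi _) (norm_nonneg _) (by positivity)
          _ = _ := by ring
      · rw [Function.notMem_support.1 fun h' => hux (support_iteratedFDeriv_subset i h'), norm_zero,
          mul_zero]
        positivity
    have hf2 : ‖iteratedFDeriv ℝ i (fun x => taylorPoly m f (u • x)) x‖ ≤
        S * (u ^ m * (u ^ q)⁻¹) := by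
      have hfun2 : (fun x => taylorPoly m f (u • x)) = fun x => ∑ j ∈ Finset.range m,
          u ^ j • ((j.factorial : ℝ)⁻¹ * iteratedFDeriv ℝ j f 0 (fun _ => x)) := by
        funext x
        exact Finset.sum_congr rfl fun j _ => taylorTerm_smul f j u x
      rw [hfun2, iteratedFDeriv_fun_sum_apply fun j _ =>
        (((contDiff_taylorTerm f j).const_smul (u ^ j)).of_le (mod_cast le_top)).contDiffAt]
      refine (norm_sum_le _ _).trans ?_
      have h6 : ∑ j ∈ Finset.range m, A j i ≤ S :=
        Finset.single_le_sum (f := fun i => ∑ j ∈ Finset.range m, A j i)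
          (fun i _ => Finset.sum_nonneg fun j _ => hA j i) (Finset.mem_range.2 (by omega))
      refine le_trans ?_ (mul_le_mul_of_nonneg_right h6 (by positivity))
      rw [Finset.sum_mul]
      refine Finset.sum_le_sum fun j hj => ?_
      rw [iteratedFDeriv_const_smul_apply' ((contDiff_taylorTerm f j).of_le
        (mod_cast le_top)).contDiffAt, norm_smul, norm_pow, Real.norm_of_nonneg hu.le, mul_comm]
      refine mul_le_mul (hA' j i x hx₁) ?_ (by positivity) (hA j i)
      rw [← div_eq_mul_inv, le_div_iff₀ (by positivity), ← pow_add]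
      have := Finset.mem_range.1 hj
      -- The index `j < m` excludes `m = 0`, so `q ≤ 1` and `j + q ≤ m`.
      exact pow_le_pow_right₀ hu1 (by omega)
    refine (norm_sub_le _ _).trans ((add_le_add hf1 hf2).trans ?_)
    rw [← add_mul]
    gcongr
    linarith

end Calculus

/-! ### Scaling exponents and the uniform dyadic estimate. -/

section Scaling

variable {n : ℕ} {U V : Opens (EuclideanSpace ℝ (Fin n))}

/-- The rescaled function `t⁻ⁿ f(x / t)`. -/
noncomputable def scale (t : ℝ) (f : EuclideanSpace ℝ (Fin n) → ℝ) (x : EuclideanSpace ℝ (Fin n)) :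
    ℝ := (t ^ n)⁻¹ * f (t⁻¹ • x)

theorem scale_one (f : EuclideanSpace ℝ (Fin n) → ℝ) : scale 1 f = f := by
  funext x
  simp [scale]

theorem contDiff_scale {f : EuclideanSpace ℝ (Fin n) → ℝ} (hf : ContDiff ℝ ∞ f) (t : ℝ) :
    ContDiff ℝ ∞ (scale t f) := contDiff_const.mul (contDiff_comp_smul hf t⁻¹)

theorem coe_rescale {r : ℝ} (hr : Metric.ball 0 r \ {0} ⊆ (U : Set (EuclideanSpace ℝ (Fin n))))
    {t : ℝ} (ht : 0 < t) (ht1 : t ≤ 1) (φ : 𝓓(ballIn U r, ℝ)) :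
    ⇑(rescale t φ) = scale t φ :=
  funext fun x => rescale_apply ht (smul_mem_ballIn hr ht ht1) φ x

theorem IsTest.scale {r : ℝ} (hr : Metric.ball 0 r \ {0} ⊆ (U : Set (EuclideanSpace ℝ (Fin n))))
    {t : ℝ} (ht : 0 < t) (ht1 : t ≤ 1) {f : EuclideanSpace ℝ (Fin n) → ℝ}
    (hf : IsTest (ballIn U r) f) : IsTest (ballIn U r) (scale t f) := by
  have := isTest_coe (rescale t hf.toTestFunction)
  rwa [coe_rescale hr ht ht1] at this

theorem app_restrict (h : V ≤ U) (T : 𝓓'(U, ℝ)) {f : EuclideanSpace ℝ (Fin n) → ℝ}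
    (hf : IsTest V f) : app (restrict h T) f = app T f := by
  rw [app_eq _ hf, app_eq T (hf.mono h)]
  refine congrArg T (TestFunction.ext fun x => ?_)
  have := TestFunction.monoCLM_apply (𝕜 := ℝ) (n₂ := ⊤) (Ω₂ := U) hf.toTestFunction
  rw [if_pos ⟨le_rfl, h⟩] at this
  exact congrFun this x

/-- Only `0 < t ≤ 1` matters for the limit, and there `rescale` agrees with the total operation
`scale`. -/
theorem isScalingExponent_iff {T : 𝓓'(U, ℝ)} {k : ℝ} : IsScalingExponent T k ↔
    ∀ r : ℝ, 0 < r → Metric.ball 0 r \ {0} ⊆ (U : Set (EuclideanSpace ℝ (Fin n))) →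
      ∀ f, IsTest (ballIn U r) f →
        Tendsto (fun t : ℝ => t ^ k * app T (scale t f)) (𝓝[>] 0) (𝓝 0) := by
  refine forall_congr' fun r => forall_congr' fun _ => forall_congr' fun hr => ?_
  have key : ∀ φ : 𝓓(ballIn U r, ℝ), (fun t : ℝ => t ^ k * restrict (ballIn_le U r) T (rescale t φ))
      =ᶠ[𝓝[>] 0] fun t : ℝ => t ^ k * app T (scale t φ) := by
    intro φ
    filter_upwards [Ioc_mem_nhdsGT (zero_lt_one' ℝ)] with t ht
    rw [← app_coe, app_restrict _ _ (isTest_coe _), coe_rescale hr ht.1 ht.2]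
  exact ⟨fun h f hf => (h hf.toTestFunction).congr' (key hf.toTestFunction),
    fun h φ => (h φ (isTest_coe φ)).congr' (key φ).symm⟩

theorem tendsto_rpow_mul_of_lt {g : ℝ → ℝ} {k k' : ℝ} (hk : k < k')
    (h : Tendsto (fun t : ℝ => t ^ k * g t) (𝓝[>] 0) (𝓝 0)) :
    Tendsto (fun t : ℝ => t ^ k' * g t) (𝓝[>] 0) (𝓝 0) := by
  have h0 : Tendsto (fun t : ℝ => t ^ (k' - k)) (𝓝[>] 0) (𝓝 0) := by
    have := (Real.continuousAt_rpow_const 0 (k' - k) (Or.inr (by linarith))).tendsto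
    rw [Real.zero_rpow (by linarith)] at this
    exact this.mono_left nhdsWithin_le_nhds
  have := h0.mul h
  rw [mul_zero] at this
  refine this.congr' ?_
  filter_upwards [self_mem_nhdsWithin] with t ht
  rw [← mul_assoc, ← Real.rpow_add ht, sub_add_cancel]

theorem IsScalingExponent.of_lt {T : 𝓓'(U, ℝ)} {k k' : ℝ} (h : IsScalingExponent T k)
    (hk : k < k') : IsScalingExponent T k' :=
  fun r hr hrU φ => tendsto_rpow_mul_of_lt hk (h r hr hrU φ)

theorem isScalingExponent_of_sd_lt {T : 𝓓'(U, ℝ)} {k : ℝ} (h : sd T < k) :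
    IsScalingExponent T k := by
  obtain ⟨_, ⟨k', hk', rfl⟩, hlt⟩ := sInf_lt_iff.1 h
  exact IsScalingExponent.of_lt hk' (EReal.coe_lt_coe_iff.1 hlt)

theorem sd_le_of_forall {T : 𝓓'(U, ℝ)} {s : EReal}
    (h : ∀ k : ℝ, s < k → IsScalingExponent T k) : sd T ≤ s :=
  EReal.le_of_forall_lt_iff_le.1 fun k hk => sInf_le ⟨k, h k hk, rfl⟩

theorem IsScalingExponent.restrict_puncture {T : 𝓓'(U, ℝ)} {k : ℝ} (h : IsScalingExponent T k) :
    IsScalingExponent (restrict (puncture_le U) T) k := by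
  rw [isScalingExponent_iff] at h ⊢
  intro r hr hrU f hf
  have hle : ballIn (puncture U) r ≤ ballIn U r := fun x hx => ⟨hx.1.1, hx.2⟩
  refine (h r hr (hrU.trans (puncture_le U)) f (hf.mono hle)).congr' ?_
  filter_upwards [Ioc_mem_nhdsGT (zero_lt_one' ℝ)] with t ht
  rw [app_restrict _ _ ((hf.scale hrU ht.1 ht.2).mono (ballIn_le _ r))]

theorem sd_restrict_puncture_le (T : 𝓓'(U, ℝ)) : sd (restrict (puncture_le U) T) ≤ sd T :=
  sd_le_of_forall fun _ hk => (isScalingExponent_of_sd_lt hk).restrict_puncture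

theorem IsScalingExponent.sub {S T : 𝓓'(U, ℝ)} {k : ℝ} (hS : IsScalingExponent S k)
    (hT : IsScalingExponent T k) : IsScalingExponent (S - T) k := by
  rw [isScalingExponent_iff] at hS hT ⊢
  intro r hr hrU f hf
  simpa only [app_sub_left, mul_sub, sub_zero] using (hS r hr hrU f hf).sub (hT r hr hrU f hf)

theorem isFunctional_app_scale (T : 𝓓'(U, ℝ)) {r : ℝ}
    (hr : Metric.ball 0 r \ {0} ⊆ (U : Set (EuclideanSpace ℝ (Fin n))))
    (K : Compacts (EuclideanSpace ℝ (Fin n))) (hK : (K : Set (EuclideanSpace ℝ (Fin n))) ⊆ ballIn U r)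
    {t : ℝ} (ht : 0 < t) (ht1 : t ≤ 1) :
    IsFunctional (K : Set (EuclideanSpace ℝ (Fin n))) (fun f => app T (scale t f)) := by
  let e := Homeomorph.smulOfNeZero (α := EuclideanSpace ℝ (Fin n)) t⁻¹ (inv_ne_zero ht.ne')
  let K' : Compacts (EuclideanSpace ℝ (Fin n)) :=
    ⟨e ⁻¹' K, e.isCompact_preimage.2 K.isCompact⟩
  have hK' : (K' : Set (EuclideanSpace ℝ (Fin n))) ⊆ U := by
    intro x hx
    have h1 := smul_mem_ballIn hr ht ht1 _ (hK (show t⁻¹ • x ∈ K from hx))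
    rw [smul_smul, mul_inv_cancel₀ ht.ne', one_smul] at h1
    exact h1.1
  have hs : ∀ f, SmoothIn (K : Set (EuclideanSpace ℝ (Fin n))) f →
      SmoothIn (K' : Set (EuclideanSpace ℝ (Fin n))) (scale t f) := fun f hf =>
    ⟨contDiff_scale hf.contDiff t, fun x hx => hf.tsupport_subset
      (tsupport_comp_subset_preimage f (f := fun x => t⁻¹ • x) (by fun_prop)
        (tsupport_mul_subset_right (f := fun _ => (t ^ n)⁻¹) hx))⟩
  have hL := isFunctional_app T K' hK'
  refine ⟨fun f g hf hg => ?_, fun c f hf => ?_, ?_⟩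
  · rw [← hL.add _ _ (hs f hf) (hs g hg)]
    congr 1; funext x; simp only [scale]; ring
  · rw [← hL.const_mul c _ (hs f hf)]
    congr 1; funext x; simp only [scale]; ring
  · obtain ⟨C, N, hC, hb⟩ := hL.bound
    refine ⟨C * ((t ^ n)⁻¹ * t⁻¹ ^ N), N, by positivity, fun f hf B hB => ?_⟩
    rw [mul_assoc]
    refine hb _ (hs f hf) _ fun i hi x => ?_
    have h1 : iteratedFDeriv ℝ i (scale t f) x =
        (t ^ n)⁻¹ • iteratedFDeriv ℝ i (fun x => f (t⁻¹ • x)) x :=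
      iteratedFDeriv_const_smul_apply' (𝕜 := ℝ) (a := (t ^ n)⁻¹) (f := fun x => f (t⁻¹ • x))
        ((contDiff_comp_smul hf.contDiff _).of_le (mod_cast le_top)).contDiffAt
    have h2 : 1 ≤ t⁻¹ := (one_le_inv₀ ht).2 ht1
    rw [h1, iteratedFDeriv_comp_smul hf.contDiff, norm_smul, norm_smul, norm_pow,
      Real.norm_of_nonneg (by positivity), Real.norm_of_nonneg (by positivity), mul_assoc]
    have := hB i hi (t⁻¹ • x)
    gcongr

theorem tendsto_pow_half : Tendsto (fun j : ℕ => (1 / 2 : ℝ) ^ j) atTop (𝓝[>] 0) :=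
  tendsto_nhdsWithin_iff.2 ⟨tendsto_pow_atTop_nhds_zero_of_lt_one (by norm_num) (by norm_num),
    Eventually.of_forall fun j => by simp⟩

/-- If `k` is a scaling exponent of `T`, then `T` tested against functions living at distance
`2⁻ʲ` from the origin is controlled by `2⁻ʲ⁽ⁿ⁻ᵏ⁾`, uniformly in the test function. -/
theorem exists_dyadic_bound {T : 𝓓'(U, ℝ)} {k r : ℝ} (hk : IsScalingExponent T k) (hr0 : 0 < r)
    (hr : Metric.ball 0 r \ {0} ⊆ (U : Set (EuclideanSpace ℝ (Fin n))))
    {η : EuclideanSpace ℝ (Fin n) → ℝ} (hη : IsTest (ballIn U r) η) :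
    ∃ C N, 0 ≤ C ∧ ∀ (j : ℕ) (t : ℝ), t = (1 / 2) ^ j →
      ∀ g : EuclideanSpace ℝ (Fin n) → ℝ, ContDiff ℝ ∞ g → ∀ B, 0 ≤ B →
        (∀ i ≤ N, ∀ x ∈ tsupport η, ‖iteratedFDeriv ℝ i (fun x => g (t • x)) x‖ ≤ B) →
        |app T (fun x => η (t⁻¹ • x) * g x)| ≤ C * (t ^ ((n : ℝ) - k) * B) := by
  rw [isScalingExponent_iff] at hk
  let K : Compacts (EuclideanSpace ℝ (Fin n)) := ⟨tsupport η, hη.hasCompactSupport⟩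
  have ht0 : ∀ j : ℕ, 0 < (1 / 2 : ℝ) ^ j := fun j => by positivity
  have ht1 : ∀ j : ℕ, (1 / 2 : ℝ) ^ j ≤ 1 := fun j => pow_le_one₀ (by norm_num) (by norm_num)
  -- Restricting the limit in `t` to `t = 2⁻ʲ` gives convergent, hence bounded, sequences for each
  -- test function.
  obtain ⟨C, N, hC, hb⟩ := exists_uniform_bound K
    (L := fun (j : ℕ) f => ((1 / 2 : ℝ) ^ j) ^ k * app T (scale ((1 / 2) ^ j) f))
    (fun j => (isFunctional_app_scale T hr K hη.tsupport_subset (ht0 j) (ht1 j)).const_mul_functional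
      _)
    (fun f hf => by
      have := (hk r hr0 hr f (hf.isTest K.isCompact hη.tsupport_subset)).comp tendsto_pow_half
      obtain ⟨M, hM⟩ := this.norm.bddAbove_range
      exact ⟨M, fun j => hM ⟨j, rfl⟩⟩)
  obtain ⟨C', hC', hb'⟩ := exists_derivBound_mul hη.contDiff hη.hasCompactSupport N
  refine ⟨C * C', N, by positivity, fun j t htj g hg B hB h => ?_⟩
  have ht : 0 < t := htj ▸ ht0 j
  have htest : IsTest (ballIn U r) (fun x => η x * g (t • x)) :=
    hη.mul_right (contDiff_comp_smul hg t)
  have h1 := hb j (fun x => η x * g (t • x))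
    ⟨htest.contDiff, tsupport_mul_subset_left (f := η)⟩ _
    (hb' _ (contDiff_comp_smul hg t) B hB h)
  -- Undoing the normalisation of `scale` produces the factor `tⁿ`, whence the exponent `n - k`.
  have h2 : (fun x => η (t⁻¹ • x) * g x) =
      fun x => t ^ n * scale t (fun x => η x * g (t • x)) x := by
    funext x
    rw [scale, smul_smul, mul_inv_cancel₀ ht.ne', one_smul, mul_inv_cancel_left₀ (by positivity)]
  rw [h2, app_const_mul T ((htest.scale hr ht (htj ▸ ht1 j)).mono (ballIn_le U r)), abs_mul,
    abs_of_pos (by positivity)]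
  rw [← htj, abs_mul, abs_of_pos (by positivity)] at h1
  rw [Real.rpow_sub ht, Real.rpow_natCast]
  calc t ^ n * |app T (scale t fun x => η x * g (t • x))|
      = t ^ n / t ^ k * (t ^ k * |app T (scale t fun x => η x * g (t • x))|) := by
        field_simp
    _ ≤ t ^ n / t ^ k * (C * (C' * B)) := by gcongr
    _ = _ := by ring

end Scaling

/-! ### A dyadic sum bounded uniformly in its starting scale. -/

section DyadicSum

theorem summable_pow_natAbs {ρ : ℝ} (h0 : 0 ≤ ρ) (h1 : ρ < 1) :
    Summable fun z : ℤ => ρ ^ z.natAbs := by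
  have := summable_geometric_of_lt_one h0 h1
  refine Summable.of_nat_of_neg ?_ ?_ <;> simpa using this

/-- With `u = 2⁻ʲ c`, the terms decay like `uᵃ` for small `u` and like `uᵃ⁻ᑫ` for large `u`. The sum
is thus dominated by a two-sided geometric series centred at the index where `u` is about `1`, and
`c` only moves the centre. -/
theorem exists_dyadic_sum_bound {a : ℝ} {q : ℕ} (ha : 0 < a) (haq : a < q) :
    ∃ C, ∀ c : ℝ, 1 ≤ c → ∀ M : ℕ, ∑ j ∈ Finset.range M,
      ((1 / 2) ^ j * c) ^ a * min 1 ((((1 / 2) ^ j * c) ^ q)⁻¹) ≤ C := by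
  set ρ : ℝ := max ((1 / 2) ^ a) ((1 / 2) ^ (q - a)) with hρ
  have hρ0 : 0 ≤ ρ := le_trans (by positivity) (le_max_left _ _)
  have hρ1 : ρ < 1 := max_lt (Real.rpow_lt_one (by norm_num) (by norm_num) ha)
    (Real.rpow_lt_one (by norm_num) (by norm_num) (by linarith))
  refine ⟨2 ^ a * ∑' z : ℤ, ρ ^ z.natAbs, fun c hc M => ?_⟩
  -- The centre `J` satisfies `2ᴶ ≤ c < 2ᴶ⁺¹`; the upper slack costs the factor `2ᵃ`.
  obtain ⟨J, hJ1, hJ2⟩ := exists_nat_pow_near hc (one_lt_two (α := ℝ))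
  have hterm : ∀ j : ℕ, ((1 / 2) ^ j * c) ^ a * min 1 ((((1 / 2) ^ j * c) ^ q)⁻¹) ≤
      2 ^ a * ρ ^ ((j : ℤ) - J).natAbs := by
    intro j
    have hu : 0 < (1 / 2 : ℝ) ^ j * c := by positivity
    have h2a : (1 : ℝ) ≤ 2 ^ a := Real.one_le_rpow (by norm_num) ha.le
    rcases le_or_gt j J with hj | hj
    · obtain ⟨d, rfl⟩ := Nat.exists_eq_add_of_le hj
      have hd : ((j : ℤ) - ((j + d : ℕ) : ℤ)).natAbs = d := by push_cast; omega
      rw [hd]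
      have hu1 : (2 : ℝ) ^ d ≤ (1 / 2) ^ j * c := by
        rw [one_div, inv_pow, inv_mul_eq_div, le_div_iff₀ (by positivity), ← pow_add, add_comm]
        exact hJ1
      calc ((1 / 2) ^ j * c) ^ a * min 1 ((((1 / 2) ^ j * c) ^ q)⁻¹)
          ≤ ((1 / 2) ^ j * c) ^ a * (((1 / 2) ^ j * c) ^ q)⁻¹ := by
            gcongr; exact min_le_right _ _
        _ = ((1 / 2) ^ j * c) ^ (a - q) := by
            rw [Real.rpow_sub hu, Real.rpow_natCast, ← div_eq_mul_inv]
        _ ≤ ((2 : ℝ) ^ d) ^ (a - q) :=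
            Real.rpow_le_rpow_of_nonpos (by positivity) hu1 (by linarith)
        _ = ((1 / 2 : ℝ) ^ (q - a)) ^ d := by
            rw [← Real.rpow_natCast, ← Real.rpow_natCast, ← Real.rpow_mul (by norm_num),
              ← Real.rpow_mul (by norm_num), one_div, Real.inv_rpow (by norm_num),
              ← Real.rpow_neg (by norm_num)]
            ring_nf
        _ ≤ ρ ^ d := by gcongr; exact le_max_right _ _
        _ ≤ 2 ^ a * ρ ^ d := le_mul_of_one_le_left (by positivity) h2a
    · obtain ⟨d, rfl⟩ := Nat.exists_eq_add_of_lt hj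
      have hd : (((J + d + 1 : ℕ) : ℤ) - J).natAbs = d + 1 := by push_cast; omega
      rw [hd]
      have hu1 : (1 / 2) ^ (J + d + 1) * c ≤ 2 * (1 / 2 : ℝ) ^ (d + 1) := by
        have h3 : (1 / 2 : ℝ) ^ (J + d + 1) * 2 ^ (J + 1) = 2 * (1 / 2) ^ (d + 1) := by
          rw [add_assoc, pow_add, one_div, inv_pow]
          field_simp
          ring
        rw [← h3]
        gcongr
      calc ((1 / 2) ^ (J + d + 1) * c) ^ a * min 1 ((((1 / 2) ^ (J + d + 1) * c) ^ q)⁻¹)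
          ≤ ((1 / 2) ^ (J + d + 1) * c) ^ a * 1 := by gcongr; exact min_le_left _ _
        _ ≤ (2 * (1 / 2 : ℝ) ^ (d + 1)) ^ a * 1 := by gcongr
        _ = 2 ^ a * ((1 / 2 : ℝ) ^ a) ^ (d + 1) := by
            rw [mul_one, Real.mul_rpow (by norm_num) (by positivity), ← Real.rpow_natCast,
              ← Real.rpow_natCast, ← Real.rpow_mul (by norm_num), ← Real.rpow_mul (by norm_num),
              mul_comm a]
        _ ≤ 2 ^ a * ρ ^ (d + 1) := by gcongr; exact le_max_left _ _
  refine (Finset.sum_le_sum fun j _ => hterm j).trans ?_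
  rw [← Finset.mul_sum]
  refine mul_le_mul_of_nonneg_left ?_ (by positivity)
  have hinj : Function.Injective fun j : ℕ => (j : ℤ) - J := fun i j h => by
    simp only at h; omega
  rw [← Finset.sum_image (s := Finset.range M) (f := fun z : ℤ => ρ ^ z.natAbs)
    (g := fun j : ℕ => (j : ℤ) - J) hinj.injOn]
  exact (summable_pow_natAbs hρ0 hρ1).sum_le_tsum _ fun z _ => by positivity

end DyadicSum

/-! ### Distributions applied to localised Taylor polynomials. -/

section Monomials

variable {n : ℕ} {U : Opens (EuclideanSpace ℝ (Fin n))}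

/-- The monomial `x_{s 0} ⋯ x_{s (j - 1)}`. -/
def monomial {j : ℕ} (s : Fin j → Fin n) (x : EuclideanSpace ℝ (Fin n)) : ℝ := ∏ i, x (s i)

theorem contDiff_monomial {j : ℕ} (s : Fin j → Fin n) : ContDiff ℝ ∞ (monomial s) := by
  refine contDiff_prod fun i _ => ?_
  exact (EuclideanSpace.proj (𝕜 := ℝ) (s i)).contDiff

theorem multilinear_diag_eq_sum {j : ℕ}
    (M : ContinuousMultilinearMap ℝ (fun _ : Fin j => EuclideanSpace ℝ (Fin n)) ℝ)
    (x : EuclideanSpace ℝ (Fin n)) :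
    M (fun _ => x) = ∑ s : Fin j → Fin n,
      M (fun i => EuclideanSpace.single (s i) (1 : ℝ)) * monomial s x := by
  have hx : x = ∑ i, x i • EuclideanSpace.single i (1 : ℝ) := by
    have := (EuclideanSpace.basisFun (Fin n) ℝ).sum_repr x
    simpa using this.symm
  conv_lhs => rw [hx]
  rw [M.map_sum]
  refine Finset.sum_congr rfl fun s _ => ?_
  rw [M.map_smul_univ, smul_eq_mul, mul_comm]
  rfl

theorem taylorPoly_eq_sum (m : ℕ) (f : EuclideanSpace ℝ (Fin n) → ℝ)
    (x : EuclideanSpace ℝ (Fin n)) :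
    taylorPoly m f x = ∑ j ∈ Finset.range m, ∑ s : Fin j → Fin n, (j.factorial : ℝ)⁻¹ *
      iteratedFDeriv ℝ j f 0 (fun i => EuclideanSpace.single (s i) (1 : ℝ)) * monomial s x := by
  refine Finset.sum_congr rfl fun j _ => ?_
  rw [multilinear_diag_eq_sum, Finset.mul_sum]
  simp_rw [mul_assoc]

/-- As a function of `f`, this is a finite combination of derivatives at the origin. It gives
continuity of the subtracted terms and, later, the combination of derivatives of `δ`. -/
theorem app_mul_taylorPoly (T : 𝓓'(U, ℝ)) {η : EuclideanSpace ℝ (Fin n) → ℝ} (hη : IsTest U η)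
    (m : ℕ) (f : EuclideanSpace ℝ (Fin n) → ℝ) :
    app T (fun x => η x * taylorPoly m f x) =
      ∑ j ∈ Finset.range m, ∑ s : Fin j → Fin n,
        ((j.factorial : ℝ)⁻¹ * app T (fun x => η x * monomial s x)) *
          iteratedFDeriv ℝ j f 0 (fun i => EuclideanSpace.single (s i) (1 : ℝ)) := by
  have h1 : (fun x => η x * taylorPoly m f x) = fun x => ∑ j ∈ Finset.range m,
      ∑ s : Fin j → Fin n, ((j.factorial : ℝ)⁻¹ *
        iteratedFDeriv ℝ j f 0 (fun i => EuclideanSpace.single (s i) (1 : ℝ))) *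
          (η x * monomial s x) := by
    funext x
    rw [taylorPoly_eq_sum, Finset.mul_sum]
    refine Finset.sum_congr rfl fun j _ => ?_
    rw [Finset.mul_sum]
    exact Finset.sum_congr rfl fun s _ => by ring
  have htest : ∀ (j : ℕ) (s : Fin j → Fin n), IsTest U (fun x => η x * monomial s x) :=
    fun j s => hη.mul_right (contDiff_monomial s)
  rw [h1, app_sum T _ fun j _ => IsTest.sum _ fun s _ => (htest j s).const_mul _]
  refine Finset.sum_congr rfl fun j _ => ?_
  rw [app_sum T _ fun s _ => (htest j s).const_mul _]
  refine Finset.sum_congr rfl fun s _ => ?_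
  rw [app_const_mul T (htest j s)]
  ring

end Monomials

/-! ### Cutoffs and dyadic annuli. -/

section Cutoffs

variable {n : ℕ} {U : Opens (EuclideanSpace ℝ (Fin n))}

/-- A smooth function with compact support in `B_R` that is `1` on a neighbourhood of `0`. -/
structure IsCutoff (R : ℝ) (χ : EuclideanSpace ℝ (Fin n) → ℝ) : Prop where
  pos : 0 < R
  contDiff : ContDiff ℝ ∞ χ
  one_of_le : ∀ x, ‖x‖ ≤ R / 4 → χ x = 1
  zero_of_le : ∀ x, R / 2 ≤ ‖x‖ → χ x = 0

theorem exists_isCutoff {R : ℝ} (hR : 0 < R) :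
    ∃ χ : EuclideanSpace ℝ (Fin n) → ℝ, IsCutoff R χ := by
  let χ : ContDiffBump (0 : EuclideanSpace ℝ (Fin n)) :=
    ⟨R / 4, R / 2, by positivity, by linarith⟩
  exact ⟨χ, hR, χ.contDiff, fun x hx => χ.one_of_mem_closedBall (mem_closedBall_zero_iff.2 hx),
    fun x hx => χ.zero_of_le_dist (by rwa [dist_zero_right])⟩

variable {R : ℝ} {χ : EuclideanSpace ℝ (Fin n) → ℝ}

theorem IsCutoff.tsupport_subset (h : IsCutoff R χ) : tsupport χ ⊆ Metric.closedBall 0 (R / 2) := by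
  refine closure_minimal (fun x hx => ?_) Metric.isClosed_closedBall
  rw [mem_closedBall_zero_iff]
  by_contra! hlt
  exact hx (h.zero_of_le x hlt.le)

theorem IsCutoff.isTest (h : IsCutoff R χ)
    (hU : Metric.ball 0 R ⊆ (U : Set (EuclideanSpace ℝ (Fin n)))) : IsTest (ballIn U R) χ := by
  have h1 : tsupport χ ⊆ Metric.ball 0 R :=
    h.tsupport_subset.trans (Metric.closedBall_subset_ball (by linarith [h.pos]))
  exact ⟨h.contDiff, (isCompact_closedBall _ _).of_isClosed_subset (isClosed_tsupport χ)
    h.tsupport_subset, fun x hx => ⟨hU (h1 hx), h1 hx⟩⟩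

theorem IsCutoff.contDiff_one_sub (h : IsCutoff R χ) : ContDiff ℝ ∞ fun x => 1 - χ x :=
  contDiff_const.sub h.contDiff

theorem IsCutoff.tsupport_one_sub_subset (h : IsCutoff R χ) :
    tsupport (fun x => 1 - χ x) ⊆ (Metric.ball 0 (R / 4))ᶜ := by
  refine closure_minimal (fun x hx => ?_) Metric.isOpen_ball.isClosed_compl
  rw [Set.mem_compl_iff, mem_ball_zero_iff, not_lt]
  by_contra! hlt
  exact hx (by simp [h.one_of_le x hlt.le])

/-- `(1 - χ(x / t)) f(x)` is a test function away from the origin. -/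
theorem IsCutoff.isTest_one_sub_mul (h : IsCutoff R χ) {f : EuclideanSpace ℝ (Fin n) → ℝ}
    (hf : IsTest U f) (c : ℝ) : IsTest (puncture U) (fun x => (1 - χ (c • x)) * f x) := by
  have h1 := hf.mul_left (contDiff_comp_smul h.contDiff_one_sub c)
  refine ⟨h1.contDiff, h1.hasCompactSupport, fun x hx => ⟨h1.tsupport_subset hx, ?_⟩⟩
  rintro rfl
  have h2 := h.tsupport_one_sub_subset (tsupport_comp_subset_preimage (fun x => 1 - χ x)
    (f := fun x => c • x) (by fun_prop)
    (tsupport_mul_subset_left (f := fun x => 1 - χ (c • x)) hx))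
  simp [h.pos] at h2

/-- The difference of the cutoff at two consecutive dyadic scales. -/
def annular (χ : EuclideanSpace ℝ (Fin n) → ℝ) (x : EuclideanSpace ℝ (Fin n)) : ℝ :=
  χ x - χ ((2 : ℝ) • x)

theorem IsCutoff.contDiff_annular (h : IsCutoff R χ) : ContDiff ℝ ∞ (annular χ) :=
  h.contDiff.sub (contDiff_comp_smul h.contDiff 2)

theorem IsCutoff.mem_tsupport_annular (h : IsCutoff R χ) {x : EuclideanSpace ℝ (Fin n)}
    (hx : x ∈ tsupport (annular χ)) : R / 8 ≤ ‖x‖ ∧ ‖x‖ ≤ R / 2 := by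
  have hsub : tsupport (annular χ) ⊆ {x | R / 8 ≤ ‖x‖ ∧ ‖x‖ ≤ R / 2} := by
    refine closure_minimal (fun x hx => ?_) ((isClosed_le continuous_const continuous_norm).inter
      (isClosed_le continuous_norm continuous_const))
    have h2 : ‖(2 : ℝ) • x‖ = 2 * ‖x‖ := by rw [norm_smul]; simp
    constructor <;> by_contra! hlt <;> refine hx ?_ <;> unfold annular
    · rw [h.one_of_le x (by linarith [norm_nonneg x, h.pos]), h.one_of_le _ (by rw [h2]; linarith),
        sub_self]
    · rw [h.zero_of_le x hlt.le, h.zero_of_le _ (by rw [h2]; linarith [h.pos]), sub_self]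
  exact hsub hx

theorem IsCutoff.isTest_annular (h : IsCutoff R χ)
    (hU : Metric.ball 0 R ⊆ (U : Set (EuclideanSpace ℝ (Fin n)))) :
    IsTest (ballIn (puncture U) R) (annular χ) := by
  refine ⟨h.contDiff_annular, (isCompact_closedBall 0 (R / 2)).of_isClosed_subset
    (isClosed_tsupport _) fun x hx => mem_closedBall_zero_iff.2 (h.mem_tsupport_annular hx).2,
    fun x hx => ?_⟩
  obtain ⟨h1, h2⟩ := h.mem_tsupport_annular hx
  have hb : x ∈ Metric.ball 0 R := mem_ball_zero_iff.2 (by linarith [h.pos])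
  refine ⟨⟨hU hb, ?_⟩, hb⟩
  rintro rfl
  rw [norm_zero] at h1
  linarith [h.pos]

theorem diff_subset_puncture (hU : Metric.ball 0 R ⊆ (U : Set (EuclideanSpace ℝ (Fin n)))) :
    Metric.ball 0 R \ {0} ⊆ (puncture U : Set (EuclideanSpace ℝ (Fin n))) :=
  Set.sdiff_subset_sdiff_left hU

/-- The annular cutoff at the scale `2⁻ʲ`. -/
noncomputable def dyadicAnnular (χ : EuclideanSpace ℝ (Fin n) → ℝ) (j : ℕ)
    (x : EuclideanSpace ℝ (Fin n)) : ℝ :=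
  annular χ (((1 / 2 : ℝ) ^ j)⁻¹ • x)

theorem IsCutoff.isTest_dyadicAnnular (h : IsCutoff R χ)
    (hU : Metric.ball 0 R ⊆ (U : Set (EuclideanSpace ℝ (Fin n)))) (j : ℕ) :
    IsTest (puncture U) (dyadicAnnular χ j) := by
  have h1 := ((h.isTest_annular hU).scale (diff_subset_puncture hU)
    (show (0 : ℝ) < (1 / 2) ^ j by positivity)
    (pow_le_one₀ (by norm_num) (by norm_num))).const_mul ((((1 / 2 : ℝ) ^ j) ^ n))
  have h2 : dyadicAnnular χ j =
      fun x => ((1 / 2 : ℝ) ^ j) ^ n * scale ((1 / 2) ^ j) (annular χ) x := by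
    funext x
    rw [scale, mul_inv_cancel_left₀ (by positivity), dyadicAnnular]
  rw [h2]
  exact h1.mono (ballIn_le _ _)

/-- The sum telescopes, because the inner cutoff of each annulus is the outer cutoff of the next. -/
theorem sum_dyadicAnnular (χ : EuclideanSpace ℝ (Fin n) → ℝ) (M : ℕ)
    (x : EuclideanSpace ℝ (Fin n)) :
    ∑ j ∈ Finset.range M, dyadicAnnular χ j x = χ x - χ (((1 / 2 : ℝ) ^ M)⁻¹ • x) := by
  have : ∀ j, dyadicAnnular χ j x =
      χ (((1 / 2 : ℝ) ^ j)⁻¹ • x) - χ (((1 / 2 : ℝ) ^ (j + 1))⁻¹ • x) := by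
    intro j
    rw [dyadicAnnular, annular, smul_smul]
    congr 3
    rw [pow_succ, mul_inv, mul_comm]
    norm_num
  simp_rw [this]
  rw [Finset.sum_range_sub']
  simp

end Cutoffs

/-! ### Construction of the extension and its scaling degree. -/

section Existence

variable {n : ℕ} {U : Opens (EuclideanSpace ℝ (Fin n))} {R : ℝ}
  {χ : EuclideanSpace ℝ (Fin n) → ℝ}

/-- The dyadic pieces of the extension. -/
noncomputable def extTerm (T₀ : 𝓓'(puncture U, ℝ)) (χ : EuclideanSpace ℝ (Fin n) → ℝ) (m : ℕ)
    (j : ℕ) (f : EuclideanSpace ℝ (Fin n) → ℝ) : ℝ :=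
  app T₀ (fun x => dyadicAnnular χ j x * taylorRem m f x)

/-- The remainder of a test function need not have compact support, so `f` and its Taylor polynomial
are treated separately: the annular factor localises one, and the other depends only on a finite
jet. -/
theorem isFunctional_extTerm (T₀ : 𝓓'(puncture U, ℝ)) (h : IsCutoff R χ)
    (hU : Metric.ball 0 R ⊆ (U : Set (EuclideanSpace ℝ (Fin n)))) (m j : ℕ)
    (K : Compacts (EuclideanSpace ℝ (Fin n))) :
    IsFunctional (K : Set (EuclideanSpace ℝ (Fin n))) (extTerm T₀ χ m j) := by
  have hη := h.isTest_dyadicAnnular hU j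
  have h1 : IsFunctional (K : Set (EuclideanSpace ℝ (Fin n)))
      (fun f => app T₀ (fun x => dyadicAnnular χ j x * f x)) :=
    (isFunctional_app T₀ ⟨_, hη.hasCompactSupport⟩ hη.tsupport_subset).comp_mul K.isCompact
      hη.contDiff Set.inter_subset_left
  have h2 : IsFunctional (K : Set (EuclideanSpace ℝ (Fin n)))
      (fun f => app T₀ (fun x => dyadicAnnular χ j x * taylorPoly m f x)) := by
    simp_rw [app_mul_taylorPoly T₀ hη]
    exact IsFunctional.finset_sum _ fun i _ => IsFunctional.finset_sum _ fun s _ =>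
      (isFunctional_iteratedFDeriv _ 0 _).const_mul_functional _
  refine (h1.add_functional (h2.const_mul_functional (-1))).congr fun f hf => ?_
  rw [extTerm, neg_one_mul, ← sub_eq_add_neg, ← app_sub T₀ (hη.mul_right hf.contDiff)
    (hη.mul_right (contDiff_taylorPoly m f))]
  congr 1
  funext x
  rw [taylorRem]
  ring

/-- A function rescaled by `l`, seen on the annulus at scale `t = 2⁻ʲ`, is the original one seen at
scale `u = t / l`. Writing `t = u l` turns `tⁿ⁻ᵏ l⁻ⁿ` into `uⁿ⁻ᵏ l⁻ᵏ`. -/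
theorem exists_bound_extTerm {T₀ : 𝓓'(puncture U, ℝ)} (h : IsCutoff R χ)
    (hU : Metric.ball 0 R ⊆ (U : Set (EuclideanSpace ℝ (Fin n)))) {k : ℝ}
    (hk : IsScalingExponent T₀ k) {m q : ℕ} (hq : m = 0 ∨ q ≤ 1)
    {f : EuclideanSpace ℝ (Fin n) → ℝ} (hf : ContDiff ℝ ∞ f) (hc : HasCompactSupport f) :
    ∃ C, 0 ≤ C ∧ ∀ l : ℝ, 0 < l → ∀ j : ℕ, |extTerm T₀ χ m j (scale l f)| ≤
      C * l ^ (-k) * (((1 / 2) ^ j * l⁻¹) ^ (n + m - k) * min 1 ((((1 / 2) ^ j * l⁻¹) ^ q)⁻¹)) := by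
  obtain ⟨C₁, N, hC₁, h₁⟩ := exists_dyadic_bound hk h.pos (diff_subset_puncture hU)
    (h.isTest_annular hU)
  obtain ⟨C₂, hC₂, h₂⟩ := exists_bound_taylorRem (ρ₁ := R / 2) hf hc
    (show 0 < R / 8 by linarith [h.pos]) hq N
  refine ⟨C₁ * C₂, by positivity, fun l hl j => ?_⟩
  set t : ℝ := (1 / 2) ^ j with ht
  have ht0 : 0 < t := by positivity
  set u : ℝ := t * l⁻¹ with hu
  have hu0 : 0 < u := by positivity
  have hrem : (fun x => taylorRem m (scale l f) (t • x)) =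
      fun x => (l ^ n)⁻¹ • taylorRem m f (u • x) := by
    funext x
    have h3 : taylorPoly m (scale l f) (t • x) = (l ^ n)⁻¹ * taylorPoly m f (l⁻¹ • t • x) :=
      taylorPoly_comp_smul hf m _ _ _
    rw [taylorRem, taylorRem, h3, scale, smul_smul, mul_comm l⁻¹ t, smul_eq_mul, mul_sub]
  have h4 := h₁ j t ht (taylorRem m (scale l f)) (contDiff_taylorRem (contDiff_scale hf l) m)
    ((l ^ n)⁻¹ * (C₂ * (u ^ m * min 1 (u ^ q)⁻¹))) (by positivity) (fun i hi x hx => by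
      obtain ⟨hx1, hx2⟩ := h.mem_tsupport_annular hx
      rw [hrem, iteratedFDeriv_const_smul_apply' ((contDiff_comp_smul (contDiff_taylorRem hf m)
        u).of_le (mod_cast le_top)).contDiffAt, norm_smul, Real.norm_of_nonneg (by positivity)]
      exact mul_le_mul_of_nonneg_left (h₂ u hu0 i hi x hx1 hx2) (by positivity))
  refine h4.trans (le_of_eq ?_)
  have htu : t = u * l := by rw [hu]; field_simp
  have h5 : t ^ ((n : ℝ) - k) = u ^ ((n : ℝ) - k) * (l ^ n * l ^ (-k)) := by
    rw [htu, Real.mul_rpow hu0.le hl.le, sub_eq_add_neg, Real.rpow_add hl, Real.rpow_natCast]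
  have h6 : u ^ ((n : ℝ) + m - k) = u ^ ((n : ℝ) - k) * u ^ m := by
    rw [← Real.rpow_natCast u m, ← Real.rpow_add hu0]
    congr 1
    ring
  rw [h5, h6]
  field_simp

/-- The partial sums defining the extension. -/
noncomputable def extPartial (T₀ : 𝓓'(puncture U, ℝ)) (χ : EuclideanSpace ℝ (Fin n) → ℝ) (m M : ℕ)
    (f : EuclideanSpace ℝ (Fin n) → ℝ) : ℝ :=
  app T₀ (fun x => (1 - χ x) * f x) + ∑ j ∈ Finset.range M, extTerm T₀ χ m j f

theorem isFunctional_extPartial (T₀ : 𝓓'(puncture U, ℝ)) (h : IsCutoff R χ)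
    (hU : Metric.ball 0 R ⊆ (U : Set (EuclideanSpace ℝ (Fin n)))) (m M : ℕ)
    (K : Compacts (EuclideanSpace ℝ (Fin n))) (hK : (K : Set (EuclideanSpace ℝ (Fin n))) ⊆ U) :
    IsFunctional (K : Set (EuclideanSpace ℝ (Fin n))) (extPartial T₀ χ m M) := by
  refine IsFunctional.add_functional ?_
    (IsFunctional.finset_sum _ fun j _ => isFunctional_extTerm T₀ h hU m j K)
  let K' : Compacts (EuclideanSpace ℝ (Fin n)) :=
    ⟨tsupport (fun x => 1 - χ x) ∩ K, K.isCompact.inter_left (isClosed_tsupport _)⟩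
  refine (isFunctional_app T₀ K' fun x hx => ⟨hK hx.2, ?_⟩).comp_mul K.isCompact
    h.contDiff_one_sub subset_rfl
  rintro rfl
  have := h.tsupport_one_sub_subset hx.1
  simp [h.pos] at this

theorem tendsto_extPartial {T₀ : 𝓓'(puncture U, ℝ)} (h : IsCutoff R χ)
    (hU : Metric.ball 0 R ⊆ (U : Set (EuclideanSpace ℝ (Fin n)))) {k : ℝ}
    (hk : IsScalingExponent T₀ k) {m : ℕ} (hkm : k < n + m)
    {f : EuclideanSpace ℝ (Fin n) → ℝ} (hf : ContDiff ℝ ∞ f) (hc : HasCompactSupport f) :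
    Tendsto (fun M => extPartial T₀ χ m M f) atTop
      (𝓝 (app T₀ (fun x => (1 - χ x) * f x) + ∑' j, extTerm T₀ χ m j f)) := by
  -- At the fixed scale `l = 1` all `u ≤ 1`, so no decay for large `u` is needed and `q = 0` will
  -- do.
  obtain ⟨C, hC, hb⟩ := exists_bound_extTerm h hU hk (q := 0) (m := m) (by simp) hf hc
  have hsum : Summable fun j => extTerm T₀ χ m j f := by
    have hg : Summable fun j : ℕ => C * ((1 / 2 : ℝ) ^ ((n : ℝ) + m - k)) ^ j :=
      (summable_geometric_of_lt_one (by positivity)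
        (Real.rpow_lt_one (by norm_num) (by norm_num) (by linarith))).mul_left C
    refine Summable.of_norm_bounded hg fun j => ?_
    have := hb 1 one_pos j
    rw [scale_one] at this
    refine this.trans (le_of_eq ?_)
    simp only [inv_one, mul_one, Real.one_rpow, pow_zero, min_self]
    rw [Real.rpow_pow_comm (by norm_num)]
  exact hsum.hasSum.tendsto_sum_nat.const_add _

/-- Since `f` vanishes near the origin, its Taylor polynomial is zero and the telescoped partial
sums eventually equal `T₀ f`. -/
theorem tendsto_extPartial_of_isTest_puncture (T₀ : 𝓓'(puncture U, ℝ)) (h : IsCutoff R χ)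
    (hU : Metric.ball 0 R ⊆ (U : Set (EuclideanSpace ℝ (Fin n)))) (m : ℕ)
    {f : EuclideanSpace ℝ (Fin n) → ℝ} (hf : IsTest (puncture U) f) :
    Tendsto (fun M => extPartial T₀ χ m M f) atTop (𝓝 (app T₀ f)) := by
  have h0 : (0 : EuclideanSpace ℝ (Fin n)) ∉ tsupport f := fun h' => (hf.tsupport_subset h').2 rfl
  have hev : f =ᶠ[𝓝 0] fun _ => 0 := notMem_tsupport_iff_eventuallyEq.1 h0
  obtain ⟨δ, hδ, hball⟩ := Metric.eventually_nhds_iff_ball.1 hev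
  have hrem : taylorRem m f = f := by
    funext x
    rw [taylorRem, taylorPoly_eq_zero hev, sub_zero]
  -- Beyond this `M` the innermost cutoff lives where `f` is zero.
  have hM : ∀ᶠ M : ℕ in atTop, (1 / 2 : ℝ) ^ M * (R / 2) < δ := by
    have := (tendsto_pow_atTop_nhds_zero_of_lt_one (r := (1 / 2 : ℝ)) (by norm_num)
      (by norm_num)).mul_const (R / 2)
    rw [zero_mul] at this
    exact this.eventually (gt_mem_nhds hδ)
  refine tendsto_const_nhds.congr' ?_
  filter_upwards [hM] with M hM
  have hηf : ∀ j, IsTest (puncture U) (fun x => dyadicAnnular χ j x * f x) := fun j =>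
    (h.isTest_dyadicAnnular hU j).mul_right hf.contDiff
  unfold extPartial extTerm
  rw [hrem, ← app_sum T₀ _ fun j _ => hηf j,
    ← app_add T₀ (hf.mul_left h.contDiff_one_sub) (IsTest.sum _ fun j _ => hηf j)]
  congr 1
  funext x
  rw [← Finset.sum_mul, sum_dyadicAnnular]
  have hz : χ (((1 / 2 : ℝ) ^ M)⁻¹ • x) * f x = 0 := by
    rcases lt_or_ge ‖x‖ δ with hx | hx
    · rw [hball x (mem_ball_zero_iff.2 hx), mul_zero]
    · rw [h.zero_of_le, zero_mul]
      rw [norm_smul, norm_inv, Real.norm_of_nonneg (by positivity), inv_mul_eq_div,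
        le_div_iff₀ (by positivity), mul_comm]
      linarith
  linear_combination hz

theorem exists_extension (T₀ : 𝓓'(puncture U, ℝ)) (hO : (0 : EuclideanSpace ℝ (Fin n)) ∈ U) {m : ℕ}
    (hm : sd T₀ < ((n + m : ℝ) : EReal)) (hm' : m = 0 ∨ ((n + m - 1 : ℝ) : EReal) ≤ sd T₀) :
    ∃ T : 𝓓'(U, ℝ), restrict (puncture_le U) T = T₀ ∧ sd T = sd T₀ := by
  obtain ⟨R, hR, hU⟩ := Metric.isOpen_iff.1 U.isOpen 0 hO
  obtain ⟨χ, h⟩ := exists_isCutoff (n := n) hR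
  obtain ⟨k₀, hk₀, hk₀m⟩ := EReal.lt_iff_exists_real_btwn.1 hm
  have hlim := fun (f : EuclideanSpace ℝ (Fin n) → ℝ) (hf : ContDiff ℝ ∞ f)
    (hc : HasCompactSupport f) => tendsto_extPartial h hU (isScalingExponent_of_sd_lt hk₀)
      (EReal.coe_lt_coe_iff.1 hk₀m) hf hc
  obtain ⟨T, hT⟩ := exists_distribution (U := U) (L := fun f =>
      app T₀ (fun x => (1 - χ x) * f x) + ∑' j, extTerm T₀ χ m j f) fun K hK =>
    IsFunctional.of_tendsto K (fun M => isFunctional_extPartial T₀ h hU m M K hK)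
      fun f hf => hlim f hf.contDiff (K.isCompact.of_isClosed_subset (isClosed_tsupport f)
        hf.tsupport_subset)
  have hlimT : ∀ f, IsTest U f → Tendsto (fun M => extPartial T₀ χ m M f) atTop (𝓝 (app T f)) :=
    fun f hf => by rw [hT f hf]; exact hlim f hf.contDiff hf.hasCompactSupport
  have hres : restrict (puncture_le U) T = T₀ := by
    refine distribution_ext fun f hf => ?_
    rw [app_restrict _ _ hf]
    exact tendsto_nhds_unique (hlimT f (hf.mono (puncture_le U)))
      (tendsto_extPartial_of_isTest_puncture T₀ h hU m hf)
  -- Restriction can only lower the scaling degree, so only the upper bound remains.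
  refine ⟨T, hres, le_antisymm ?_ (by rw [← hres]; exact sd_restrict_puncture_le T)⟩
  refine sd_le_of_forall fun k hk => ?_
  rw [isScalingExponent_iff]
  intro r hr hrU f hf
  -- The auxiliary exponent lies strictly between `sd T₀` and both `k` and `n + m`; the gap `k - k'`
  -- will force the limit to be `0`.
  obtain ⟨k', hk', hk'lt⟩ := EReal.lt_iff_exists_real_btwn.1 (lt_min hk hm)
  have hk'k : k' < k := EReal.coe_lt_coe_iff.1 (hk'lt.trans_le (min_le_left _ _))
  have hk'm : k' < n + m := EReal.coe_lt_coe_iff.1 (hk'lt.trans_le (min_le_right _ _))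
  -- For `m = 0` the degree may be very negative, so `q` must be able to grow; otherwise the
  -- minimality of `m` in `hm'` makes `q = 1` enough.
  obtain ⟨q, hq, hqa⟩ : ∃ q : ℕ, (m = 0 ∨ q ≤ 1) ∧ (n + m - k' : ℝ) < q := by
    rcases hm' with hm' | hm'
    · obtain ⟨q, hq⟩ := exists_nat_gt (n + m - k' : ℝ)
      exact ⟨q, Or.inl hm', hq⟩
    · refine ⟨1, Or.inr le_rfl, ?_⟩
      have := EReal.coe_lt_coe_iff.1 (hm'.trans_lt hk')
      push_cast
      linarith
  obtain ⟨C, hC, hb⟩ := exists_bound_extTerm h hU (isScalingExponent_of_sd_lt hk') hq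
    hf.contDiff hf.hasCompactSupport
  obtain ⟨D, hD⟩ := exists_dyadic_sum_bound (a := n + m - k') (q := q) (by linarith) hqa
  obtain ⟨ρ, hρ⟩ := hf.hasCompactSupport.isCompact.isBounded.subset_closedBall
    (0 : EuclideanSpace ℝ (Fin n))
  have hsmall : ∀ᶠ l : ℝ in 𝓝[>] 0, l * ρ ≤ R / 4 := by
    have h1 : Tendsto (fun l : ℝ => l * ρ) (𝓝[>] 0) (𝓝 (0 * ρ)) :=
      (tendsto_id.mul_const ρ).mono_left nhdsWithin_le_nhds
    rw [zero_mul] at h1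
    exact (h1.eventually (gt_mem_nhds (show 0 < R / 4 by positivity))).mono fun l hl => hl.le
  have hbound : ∀ᶠ l : ℝ in 𝓝[>] 0, |app T (scale l f)| ≤ C * l ^ (-k') * D := by
    filter_upwards [hsmall, Ioc_mem_nhdsGT (zero_lt_one' ℝ)] with l hl hl01
    have hl0 : 0 < l := hl01.1
    refine le_of_tendsto (hlimT _ ((hf.scale hrU hl01.1 hl01.2).mono (ballIn_le _ _))).abs
      (Eventually.of_forall fun M => ?_)
    -- For small `l` the rescaled function lives where `χ = 1`, and only the series contributes.
    have hz : (fun x => (1 - χ x) * scale l f x) = fun _ => 0 := by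
      funext x
      by_cases hx : l⁻¹ • x ∈ tsupport f
      · have h2 := mem_closedBall_zero_iff.1 (hρ hx)
        rw [norm_smul, norm_inv, Real.norm_of_nonneg hl0.le, inv_mul_le_iff₀ hl0] at h2
        rw [h.one_of_le x (h2.trans hl), sub_self, zero_mul]
      · rw [scale, image_eq_zero_of_notMem_tsupport hx, mul_zero, mul_zero]
    rw [extPartial, hz, app_zero, zero_add]
    refine (Finset.abs_sum_le_sum_abs _ _).trans ((Finset.sum_le_sum fun j _ => hb l hl0 j).trans ?_)
    rw [← Finset.mul_sum]
    exact mul_le_mul_of_nonneg_left (hD l⁻¹ ((one_le_inv₀ hl0).2 hl01.2) M) (by positivity)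
  have hzero : Tendsto (fun l : ℝ => C * D * l ^ (k - k')) (𝓝[>] 0) (𝓝 0) := by
    have := (Real.continuousAt_rpow_const 0 (k - k') (Or.inr (by linarith))).tendsto
    rw [Real.zero_rpow (by linarith)] at this
    simpa using (this.mono_left nhdsWithin_le_nhds).const_mul (C * D)
  refine squeeze_zero_norm' ?_ hzero
  filter_upwards [hbound, self_mem_nhdsWithin] with l hl hl0
  have hl0 : 0 < l := hl0
  rw [norm_mul, Real.norm_of_nonneg (by positivity)]
  calc l ^ k * ‖app T (scale l f)‖ ≤ l ^ k * (C * l ^ (-k') * D) := by gcongr; exact hl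
    _ = C * D * (l ^ k * l ^ (-k')) := by ring
    _ = C * D * l ^ (k - k') := by rw [← Real.rpow_add hl0, ← sub_eq_add_neg]

end Existence

/-! ### Distributions supported at the origin. -/

section Uniqueness

variable {n : ℕ} {U : Opens (EuclideanSpace ℝ (Fin n))} {T : 𝓓'(U, ℝ)}

theorem app_eq_zero_of_isTest_puncture (hT : restrict (puncture_le U) T = 0)
    {f : EuclideanSpace ℝ (Fin n) → ℝ} (hf : IsTest (puncture U) f) : app T f = 0 := by
  rw [← app_restrict (puncture_le U) T hf, hT, app_eq _ hf]
  rfl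

/-- Localising to any scale `t = 2⁻ʲ` does not change `T f`, as `T` vanishes off the origin. The
localised value is `O(tⁿ⁻ᵏ tᵐ)`, which tends to `0`. -/
theorem app_eq_zero_of_jet_eq_zero (hO : (0 : EuclideanSpace ℝ (Fin n)) ∈ U)
    (hT : restrict (puncture_le U) T = 0) {k : ℝ} (hk : IsScalingExponent T k) {m : ℕ}
    (hkm : k < n + m) {f : EuclideanSpace ℝ (Fin n) → ℝ} (hf : IsTest U f)
    (h0 : ∀ i < m, iteratedFDeriv ℝ i f 0 = 0) : app T f = 0 := by
  obtain ⟨R, hR, hU⟩ := Metric.isOpen_iff.1 U.isOpen 0 hO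
  obtain ⟨χ, h⟩ := exists_isCutoff (n := n) hR
  obtain ⟨C, N, hC, hb⟩ := exists_dyadic_bound hk hR (Set.sdiff_subset.trans hU) (h.isTest hU)
  obtain ⟨C', hC', hb'⟩ := exists_bound_of_jet_eq_zero hf.contDiff h0 (R / 2) N
  have hle : ∀ j : ℕ, |app T f| ≤ C * C' * ((1 / 2 : ℝ) ^ ((n : ℝ) + m - k)) ^ j := by
    intro j
    have ht : (0 : ℝ) < (1 / 2) ^ j := by positivity
    have ht1 : ((1 : ℝ) / 2) ^ j ≤ 1 := pow_le_one₀ (by norm_num) (by norm_num)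
    set t : ℝ := (1 / 2) ^ j with htj
    have h1 := h.isTest_one_sub_mul hf t⁻¹
    have h2 : IsTest U fun x => χ (t⁻¹ • x) * f x :=
      hf.mul_left (contDiff_comp_smul h.contDiff t⁻¹)
    have h3 : app T f = app T fun x => χ (t⁻¹ • x) * f x := by
      rw [← zero_add (app T fun x => χ (t⁻¹ • x) * f x), ← app_eq_zero_of_isTest_puncture hT h1,
        ← app_add T (h1.mono (puncture_le U)) h2]
      congr 1
      funext x
      ring
    rw [h3]
    refine (hb j t htj f hf.contDiff (C' * t ^ m) (by positivity) fun i hi x hx =>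
      hb' t ht ht1 i hi x (mem_closedBall_zero_iff.1 (h.tsupport_subset hx))).trans (le_of_eq ?_)
    rw [Real.rpow_pow_comm (by norm_num), ← htj,
      show (n : ℝ) + m - k = (n - k) + m by ring, Real.rpow_add ht, Real.rpow_natCast]
    ring
  have hlim : Tendsto (fun j : ℕ => C * C' * ((1 / 2 : ℝ) ^ ((n : ℝ) + m - k)) ^ j) atTop
      (𝓝 (C * C' * 0)) :=
    (tendsto_pow_atTop_nhds_zero_of_lt_one (by positivity)
      (Real.rpow_lt_one (by norm_num) (by norm_num) (by linarith))).const_mul _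
  rw [mul_zero] at hlim
  exact abs_nonpos_iff.1 (ge_of_tendsto' hlim hle)

theorem exists_app_eq_app_taylorPoly (hO : (0 : EuclideanSpace ℝ (Fin n)) ∈ U)
    (hT : restrict (puncture_le U) T = 0) {k : ℝ} (hk : IsScalingExponent T k) {m : ℕ}
    (hkm : k < n + m) : ∃ χ, IsTest U χ ∧ ∀ f, IsTest U f →
      app T f = app T fun x => χ x * taylorPoly m f x := by
  obtain ⟨R, hR, hU⟩ := Metric.isOpen_iff.1 U.isOpen 0 hO
  obtain ⟨χ, h⟩ := exists_isCutoff (n := n) hR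
  have hχ : IsTest U χ := (h.isTest hU).mono (ballIn_le U R)
  refine ⟨χ, hχ, fun f hf => ?_⟩
  have h1 : IsTest U fun x => χ x * taylorPoly m f x := hχ.mul_right (contDiff_taylorPoly m f)
  rw [← sub_eq_zero, ← app_sub T hf h1]
  -- Near the origin `χ = 1`, so the difference has the jet of the Taylor remainder.
  refine app_eq_zero_of_jet_eq_zero hO hT hk hkm (hf.sub h1) fun i hi => ?_
  have hev : (fun x => f x - χ x * taylorPoly m f x) =ᶠ[𝓝 0] taylorRem m f := by
    filter_upwards [Metric.ball_mem_nhds (0 : EuclideanSpace ℝ (Fin n))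
      (show 0 < R / 4 by positivity)] with x hx
    rw [h.one_of_le x (mem_ball_zero_iff.1 hx).le, one_mul, taylorRem]
  rw [(hev.iteratedFDeriv ℝ i).eq_of_nhds, iteratedFDeriv_taylorRem hf.contDiff hi]

end Uniqueness

/-! ### Derivatives of the delta distribution and multi-indices. -/

section PartialDeriv

variable {n : ℕ} {U : Opens (EuclideanSpace ℝ (Fin n))}

theorem foldr_replicate_eq_iterate {ι X : Type*} (D : ι → X → X) (i : ι) (k : ℕ) (x : X) :
    (List.replicate k i).foldr D x = (D i)^[k] x := by
  induction k with
  | zero => rfl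
  | succ k ih => rw [List.replicate_succ, List.foldr_cons, ih, Function.iterate_succ_apply']

theorem foldr_iterate_eq_foldr_flatMap {ι X : Type*} (D : ι → X → X) (α : ι → ℕ) (l : List ι)
    (x : X) : l.foldr (fun i y => (D i)^[α i] y) x =
      (l.flatMap fun i => List.replicate (α i) i).foldr D x := by
  induction l with
  | nil => rfl
  | cons i l ih =>
    rw [List.foldr_cons, ih, List.flatMap_cons, List.foldr_append, foldr_replicate_eq_iterate]

theorem coe_lineDerivOp (φ : 𝓓(U, ℝ)) (v : EuclideanSpace ℝ (Fin n)) :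
    ((∂_{v} φ : 𝓓(U, ℝ)) : EuclideanSpace ℝ (Fin n) → ℝ) = fun x => fderiv ℝ φ x v := by
  funext x
  rw [TestFunction.lineDerivOp_eq_lineDerivCLM (𝕜 := ℝ), TestFunction.lineDerivCLM_eq_fderivCLM,
    TestFunction.fderivCLM_apply]
  simp

/-- Each derivative moves onto the test function with a sign. This reverses the order of the list,
which is restored by commutation. -/
theorem foldr_lineDerivOp_delta_apply (l : List (Fin n)) (φ : 𝓓(U, ℝ)) :
    l.foldr (fun i (S : 𝓓'(U, ℝ)) => ∂_{EuclideanSpace.single i (1 : ℝ)} S)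
      (Distribution.delta 0 : 𝓓'(U, ℝ)) φ =
      (-1) ^ l.length * listDeriv (l.map fun i => EuclideanSpace.single i (1 : ℝ)) φ 0 := by
  induction l generalizing φ with
  | nil => simp [listDeriv]
  | cons i l ih =>
    rw [List.foldr_cons, Distribution.lineDerivOp_apply_apply, map_neg, ih, coe_lineDerivOp,
      List.map_cons, listDeriv_perm φ.contDiff (List.perm_append_singleton _ _).symm,
      List.length_cons, pow_succ]
    simp [listDeriv, List.foldr_append]

/-- The multi-index counting the occurrences of each index in a tuple. -/
def multiIndex {j : ℕ} (s : Fin j → Fin n) (i : Fin n) : ℕ := (List.ofFn s).count i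

theorem sum_multiIndex {j : ℕ} (s : Fin j → Fin n) : ∑ i, multiIndex s i = j := by
  have := Multiset.sum_count_eq_card (s := Finset.univ) (m := (List.ofFn s : Multiset (Fin n)))
    (fun _ _ => Finset.mem_univ _)
  simpa [multiIndex] using this

theorem flatMap_replicate_multiIndex_perm {j : ℕ} (s : Fin j → Fin n) :
    ((List.finRange n).flatMap fun i => List.replicate (multiIndex s i) i).Perm (List.ofFn s) := by
  rw [List.perm_iff_count]
  intro a
  rw [List.count_flatMap]
  simp [Function.comp_def, List.count_replicate, multiIndex, ← List.ofFn_eq_map, List.sum_ofFn]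

theorem partialDeriv_multiIndex_delta_apply {j : ℕ} (s : Fin j → Fin n) (φ : 𝓓(U, ℝ)) :
    partialDeriv (multiIndex s) (Distribution.delta 0 : 𝓓'(U, ℝ)) φ =
      (-1) ^ j * iteratedFDeriv ℝ j φ 0 (fun i => EuclideanSpace.single (s i) (1 : ℝ)) := by
  have hp := flatMap_replicate_multiIndex_perm s
  rw [partialDeriv, foldr_iterate_eq_foldr_flatMap (fun i (S : 𝓓'(U, ℝ)) =>
    ∂_{EuclideanSpace.single i (1 : ℝ)} S), foldr_lineDerivOp_delta_apply, hp.length_eq,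
    List.length_ofFn, listDeriv_perm φ.contDiff (hp.map _), iteratedFDeriv_eq_listDeriv φ.contDiff,
    List.map_ofFn]
  rfl

theorem exists_eq_sum_partialDeriv_delta (hO : (0 : EuclideanSpace ℝ (Fin n)) ∈ U) {T : 𝓓'(U, ℝ)}
    (hT : restrict (puncture_le U) T = 0) {k : ℝ} (hk : IsScalingExponent T k) {m : ℕ}
    (hkm : k < n + m) : ∃ c : (Fin n → ℕ) →₀ ℝ, (∀ α ∈ c.support, ∑ i, α i < m) ∧
      T = c.sum fun α a => a • partialDeriv α (Distribution.delta 0 : 𝓓'(U, ℝ)) := by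
  obtain ⟨χ, hχ, hTχ⟩ := exists_app_eq_app_taylorPoly hO hT hk hkm
  -- Tuples with the same multi-index contribute to the same coefficient, hence a sum of
  -- `Finsupp.single`. The sign cancels the one produced by `∂^α δ`.
  refine ⟨∑ j ∈ Finset.range m, ∑ s : Fin j → Fin n, Finsupp.single (multiIndex s)
    ((-1) ^ j * ((j.factorial : ℝ)⁻¹ * app T (fun x => χ x * monomial s x))), fun α hα => ?_, ?_⟩
  · obtain ⟨j, hj, hα⟩ := Finset.mem_biUnion.1 (Finsupp.support_finsetSum hα)
    obtain ⟨s, -, hα⟩ := Finset.mem_biUnion.1 (Finsupp.support_finsetSum hα)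
    rw [Finset.mem_singleton.1 (Finsupp.support_single_subset hα), sum_multiIndex]
    exact Finset.mem_range.1 hj
  · rw [← Finsupp.linearCombination_apply ℝ, map_sum]
    simp only [map_sum, Finsupp.linearCombination_single]
    ext φ
    rw [← app_coe T φ, hTχ φ (isTest_coe φ), app_mul_taylorPoly T hχ]
    have hsum : ∀ {ι : Type} (s : Finset ι) (S : ι → 𝓓'(U, ℝ)),
        (∑ i ∈ s, S i) φ = ∑ i ∈ s, S i φ := by
      intro ι s S
      induction s using Finset.cons_induction with
      | empty => rfl
      | cons a s ha ih => rw [Finset.sum_cons, Finset.sum_cons, ← ih]; rfl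
    rw [hsum]
    refine Finset.sum_congr rfl fun j _ => ?_
    rw [hsum]
    refine Finset.sum_congr rfl fun s _ => ?_
    change _ = _ * (partialDeriv (multiIndex s) (Distribution.delta 0 : 𝓓'(U, ℝ)) φ)
    rw [partialDeriv_multiIndex_delta_apply]
    have : (-1 : ℝ) ^ j * (-1) ^ j = 1 := by rw [← mul_pow]; simp
    linear_combination (-(j.factorial : ℝ)⁻¹ * app T (fun x => χ x * monomial s x) *
      iteratedFDeriv ℝ j φ 0 (fun i => EuclideanSpace.single (s i) (1 : ℝ))) * this

end PartialDeriv

/-! ### The degree of divergence and the assembly of the result. -/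

section Main

variable {n : ℕ} {U V : Opens (EuclideanSpace ℝ (Fin n))}

theorem deg_lt_iff {T : 𝓓'(U, ℝ)} {x : ℝ} : deg T < x ↔ sd T < ((n + x : ℝ) : EReal) := by
  rw [deg, EReal.sub_lt_iff (Or.inl (EReal.coe_ne_bot _)) (Or.inl (EReal.coe_ne_top _)), add_comm,
    ← EReal.coe_add]

theorem le_deg_iff {T : 𝓓'(U, ℝ)} {x : ℝ} : x ≤ deg T ↔ ((n + x : ℝ) : EReal) ≤ sd T := by
  rw [← not_lt, deg_lt_iff, not_lt]

/-- The number of derivatives at the origin to be subtracted in order to extend `T`. -/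
theorem exists_order {T : 𝓓'(U, ℝ)} (hT : deg T < ⊤) : ∃ m : ℕ, deg T < ((m : ℝ) : EReal) ∧
    (m = 0 ∨ ((m - 1 : ℝ) : EReal) ≤ deg T) ∧ (deg T < 0 → m = 0) := by
  rcases lt_or_ge (deg T) 0 with h | h
  · exact ⟨0, by simpa using h, Or.inl rfl, fun _ => rfl⟩
  · obtain ⟨d, hd⟩ : ∃ d : ℝ, deg T = d :=
      ⟨(deg T).toReal, (EReal.coe_toReal hT.ne (EReal.bot_lt_zero.trans_le h).ne').symm⟩
    rw [hd] at h ⊢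
    have hd0 : 0 ≤ d := EReal.coe_nonneg.1 h
    refine ⟨⌊d⌋₊ + 1, ?_, Or.inr ?_, fun h' => absurd h' h.not_gt⟩
    · rw [EReal.coe_lt_coe_iff]
      exact_mod_cast Nat.lt_floor_add_one d
    · rw [EReal.coe_le_coe_iff]
      simpa using Nat.floor_le hd0

theorem exists_isExtensionOfSameDegree (hO : (0 : EuclideanSpace ℝ (Fin n)) ∈ U)
    {T₀ : 𝓓'(puncture U, ℝ)} (hT₀ : deg T₀ < ⊤) : ∃ T, IsExtensionOfSameDegree T₀ T := by
  obtain ⟨m, hm, hm', -⟩ := exists_order hT₀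
  obtain ⟨T, hT, hsd⟩ := exists_extension T₀ hO (deg_lt_iff.1 hm)
    (hm'.imp_right fun h => by rw [add_sub_assoc]; exact le_deg_iff.1 h)
  exact ⟨T, hT, by rw [deg, deg, hsd]⟩

theorem IsExtensionOfSameDegree.exists_sub_eq (hO : (0 : EuclideanSpace ℝ (Fin n)) ∈ U)
    {T₀ : 𝓓'(puncture U, ℝ)} {T₁ T₂ : 𝓓'(U, ℝ)} (h₁ : IsExtensionOfSameDegree T₀ T₁)
    (h₂ : IsExtensionOfSameDegree T₀ T₂) {m : ℕ} (hm : deg T₀ < ((m : ℝ) : EReal)) :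
    ∃ c : (Fin n → ℕ) →₀ ℝ, (∀ α ∈ c.support, ∑ i, α i < m) ∧
      T₁ - T₂ = c.sum fun α a => a • partialDeriv α (Distribution.delta 0 : 𝓓'(U, ℝ)) := by
  have hs₁ := deg_lt_iff.1 (h₁.2.trans_lt hm)
  have hs₂ := deg_lt_iff.1 (h₂.2.trans_lt hm)
  -- One `k` above both scaling degrees is an exponent of both extensions, hence of their
  -- difference.
  obtain ⟨k, hk, hkm⟩ := EReal.lt_iff_exists_real_btwn.1 (max_lt hs₁ hs₂)
  have hres : restrict (puncture_le U) (T₁ - T₂) = 0 := by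
    have h : restrict (puncture_le U) T₁ - restrict (puncture_le U) T₂ = 0 := by
      rw [h₁.1, h₂.1, sub_self]
    exact h
  exact exists_eq_sum_partialDeriv_delta hO hres
    ((isScalingExponent_of_sd_lt ((le_max_left _ _).trans_lt hk)).sub
      (isScalingExponent_of_sd_lt ((le_max_right _ _).trans_lt hk))) (EReal.coe_lt_coe_iff.1 hkm)

end Main

end ScalingDegree

theorem mainTheorem10 (n : ℕ) (Ω : Opens (EuclideanSpace ℝ (Fin n)))
    (hO : (0 : EuclideanSpace ℝ (Fin n)) ∈ Ω)
    (T₀ : 𝓓'(ScalingDegree.puncture Ω, ℝ)) (hT₀ : ScalingDegree.deg T₀ < ⊤) :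
    (∃ T : 𝓓'(Ω, ℝ), ScalingDegree.IsExtensionOfSameDegree T₀ T) ∧
    (ScalingDegree.deg T₀ < 0 →
      ∃! T : 𝓓'(Ω, ℝ), ScalingDegree.IsExtensionOfSameDegree T₀ T) ∧
    (0 ≤ ScalingDegree.deg T₀ →
      ∀ T₁ T₂ : 𝓓'(Ω, ℝ), ScalingDegree.IsExtensionOfSameDegree T₀ T₁ →
        ScalingDegree.IsExtensionOfSameDegree T₀ T₂ →
        ∃ c : (Fin n → ℕ) →₀ ℝ,
          (∀ α ∈ c.support, (((∑ i, α i : ℕ) : ℝ) : EReal) ≤ ScalingDegree.deg T₀) ∧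
          T₁ - T₂ = c.sum fun α a =>
            a • ScalingDegree.partialDeriv α (Distribution.delta 0 : 𝓓'(Ω, ℝ))) := by
  obtain ⟨m, hm, hm', hm0⟩ := ScalingDegree.exists_order hT₀
  obtain ⟨T, hT⟩ := ScalingDegree.exists_isExtensionOfSameDegree hO hT₀
  refine ⟨⟨T, hT⟩, fun hneg => ⟨T, hT, fun T' hT' => ?_⟩, fun _ T₁ T₂ h₁ h₂ => ?_⟩
  · obtain ⟨c, hc, hsum⟩ := hT'.exists_sub_eq hO hT hm
    -- Negative degree means `m = 0`, and no multi-index has length below `0`.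
    have hc0 : c = 0 := Finsupp.support_eq_empty.1 <| Finset.eq_empty_of_forall_notMem
      fun α hα => by simpa [hm0 hneg] using hc α hα
    rw [hc0, Finsupp.sum_zero_index] at hsum
    exact sub_eq_zero.1 hsum
  · obtain ⟨c, hc, hsum⟩ := h₁.exists_sub_eq hO h₂ hm
    refine ⟨c, fun α hα => ?_, hsum⟩
    have hlt := hc α hα
    -- Integrality turns `|α| < m` into `|α| ≤ m - 1`, which is at most `deg T₀`; the strict
    -- inequality also excludes `m = 0`.
    refine le_trans (EReal.coe_le_coe_iff.2 ?_) (hm'.resolve_left (Nat.ne_zero_of_lt hlt))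
    rw [le_sub_iff_add_le]
    exact_mod_cast hlt
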